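/- Let $q,\tau\in\mathbb C$ with $0<|q|<1$ and $q=e^{2\pi i\tau}$. Write $x=e^{2\pi i z}$ for $z\in\mathbb C$, $\mathbb H^-=\{z:\operatorname{Im} z<0\}$, $(a;q)=\prod_{n\ge 0}(1-q^na)$, $(a;q)_n=\prod_{k=0}^{n-1}(1-aq^k)$, $\langle a;q\rangle=(a;q)(q/a;q)$, and $$[-qx^5;k]=\sum_{n\in\mathbb Z}(-q)^n q^{5n(n-1)/2+kn}x^{5n+k}\qquad(k\in\mathbb Z).$$ For $D\subseteq\mathbb C$ a domain stable under translation by $\mathbb Z$ and $f\neq 0$ an entire $1$-periodic function, let $\mathcal T_D(f)$ (resp. $\mathcal S_D(f)$) be the space of $1$-periodic holomorphic functions $F$ on $D$ with $F(z)=f(z)F(z+\tau)$ whenever $z,z+\tau\in D$ (resp. $F(z)=f(z)F(-z)$ whenever $z,-z\in D$). Then $\mathcal T_{\mathbb H^-}(qx^2-x)$ has a basis $\{[qx^2-x;0],[qx^2-x;1]\}$ in which $[qx^2-x;k]$ is the unique element of this space whose Fourier expansion in $\mathbb H^-$ has coefficient of $x^j$ equal to $1$ if $j=k$ and to $0$ if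 $j\ne k$, for $j\in\{0,1\}$; both functions continue meromorphically to $\mathbb C$. The functions $[-qx^5;1]+[-qx^5;2]$ and $[-qx^5;0]+[-qx^5;3]$ form a basis of $\mathcal T_{\mathbb C}(-qx^5)\cap\mathcal S_{\mathbb C}(x^3)$. The two bases are proportional: as meromorphic functions of $z\in\mathbb C$, $$-\frac{\langle x^2;q\rangle}{(qx;q)}=\frac{[-qx^5;1]+[-qx^5;2]}{[qx^2-x;0]}=\frac{[-qx^5;0]+[-qx^5;3]}{[qx^2-x;1]}.$$ The left-hand side equals minus the ratio of the septuple product $\Pi_7=(q;q)\langle x;q\rangle\langle qx^2;q^2\rangle\langle x^2;q^2\rangle$ to the product $\Pi=(q;q)\langle x;q\rangle(qx;q)$. Consequently, for all $a_0,a_1\in\mathbb C$ (not depending on $z$), $$\Pi_7=-a_0\bigl([-qx^5;1]+[-qx^5;2]\bigr)+a_1\bigl([-qx^5;0]+[-qx^5;3]\bigr)\ \text{ on }\mathbb C$$ holds if and only if $\Pi=a_0[qx^2-x;0]-a_1[qx^2-x;1]$ on $\mathbb H^-$; and the septuple identity $$\Pi_7=-\frac{[-qx^5;1]+[-qx^5;2]}{\langle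 q^2;q^5\rangle}+\frac{[-qx^5;0]+[-qx^5;3]}{\langle q;q^5\rangle}\quad(z\in\mathbb C)$$ is equivalent to the two-variable Rogers–Ramanujan statement $$\Pi=\sum_{m\in\mathbb Z,\,n\ge 0}\frac{q^{\binom m2+\binom{n+1}2}}{(q;q)_n}(-x)^{m+n}=\frac{[qx^2-x;0]}{\langle q^2;q^5\rangle}-\frac{[qx^2-x;1]}{\langle q;q^5\rangle}\quad(z\in\mathbb H^-).$$ -/

import Mathlib

noncomputable section

/-- The variable `x = e^{2 π i z}`; also `q = ex τ`. -/
def ex (z : ℂ) : ℂ := Complex.exp (2 * Real.pi * Complex.I * z)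

/-- The infinite product `(a; q) = ∏_{n ≥ 0} (1 - qⁿ a)`. -/
def qProd (a q : ℂ) : ℂ := ∏' n : ℕ, (1 - q ^ n * a)

/-- The double product `⟨a; q⟩ = (a; q) (q / a; q)`. -/
def thetaProd (a q : ℂ) : ℂ := qProd a q * qProd (q / a) q

/-- The finite product `(a; q)_n = ∏_{0 ≤ k < n} (1 - a q^k)`. -/
def qProdFin (a q : ℂ) (n : ℕ) : ℂ := ∏ k ∈ Finset.range n, (1 - a * q ^ k)

/-- The theta function `[α x^d; k](z) = ∑_{n ∈ ℤ} αⁿ q^{d n(n-1)/2 + k n} x^{d n + k}`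
(`n(n-1)` is even, so the integer division is exact). -/
def monomialVec (q α : ℂ) (d k : ℤ) (z : ℂ) : ℂ :=
  ∑' n : ℤ, α ^ n * q ^ (d * (n * (n - 1) / 2) + k * n) * ex z ^ (d * n + k)

/-- The open lower half-plane `H⁻`. -/
def lowerHalf : Set ℂ := {z | z.im < 0}

/-- `Hol(D/ℤ)`, the holomorphic functions on `D` of period `1`, for an open set `D` that is
stable under translation by `ℤ`. A function on `D` is represented by its extension by zero
to `ℂ`, so that two elements are equal exactly when they agree on `D`. -/
def HolPer (D : Set ℂ) : Submodule ℂ (ℂ → ℂ) where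
  carrier := {F | DifferentiableOn ℂ F D ∧ (∀ z ∈ D, F (z + 1) = F z) ∧ ∀ z ∉ D, F z = 0}
  zero_mem' := ⟨differentiableOn_const 0, fun _ _ => rfl, fun _ _ => rfl⟩
  add_mem' := by
    rintro F G ⟨hF, hF1, hF0⟩ ⟨hG, hG1, hG0⟩
    refine ⟨hF.add hG, fun z hz => ?_, fun z hz => ?_⟩
    · simp [hF1 z hz, hG1 z hz]
    · simp [hF0 z hz, hG0 z hz]
  smul_mem' := by
    rintro c F ⟨hF, hF1, hF0⟩
    refine ⟨hF.const_smul c, fun z hz => ?_, fun z hz => ?_⟩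
    · simp [hF1 z hz]
    · simp [hF0 z hz]

/-- `T_D(f)`: the `F ∈ Hol(D/ℤ)` with `F(z) = f(z) F(z + τ)` whenever `z, z + τ ∈ D`,
for a nonzero entire function `f` of period `1`. -/
def TSpace (τ : ℂ) (D : Set ℂ) (f : ℂ → ℂ) : Submodule ℂ (ℂ → ℂ) where
  carrier := {F | F ∈ HolPer D ∧ ∀ z, z ∈ D → z + τ ∈ D → F z = f z * F (z + τ)}
  zero_mem' := ⟨Submodule.zero_mem _, fun _ _ _ => by simp⟩
  add_mem' := by
    rintro F G ⟨hF, hF1⟩ ⟨hG, hG1⟩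
    refine ⟨Submodule.add_mem _ hF hG, fun z hz hz' => ?_⟩
    simp only [Pi.add_apply]
    rw [hF1 z hz hz', hG1 z hz hz']
    ring
  smul_mem' := by
    rintro c F ⟨hF, hF1⟩
    refine ⟨Submodule.smul_mem _ c hF, fun z hz hz' => ?_⟩
    simp only [Pi.smul_apply, smul_eq_mul]
    rw [hF1 z hz hz']
    ring

/-- `S_D(f)`: the `F ∈ Hol(D/ℤ)` with `F(z) = f(z) F(-z)` whenever `z, -z ∈ D`,
for a nonzero entire function `f` of period `1`. -/
def SSpace (D : Set ℂ) (f : ℂ → ℂ) : Submodule ℂ (ℂ → ℂ) where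
  carrier := {F | F ∈ HolPer D ∧ ∀ z, z ∈ D → -z ∈ D → F z = f z * F (-z)}
  zero_mem' := ⟨Submodule.zero_mem _, fun _ _ _ => by simp⟩
  add_mem' := by
    rintro F G ⟨hF, hF1⟩ ⟨hG, hG1⟩
    refine ⟨Submodule.add_mem _ hF hG, fun z hz hz' => ?_⟩
    simp only [Pi.add_apply]
    rw [hF1 z hz hz', hG1 z hz hz']
    ring
  smul_mem' := by
    rintro c F ⟨hF, hF1⟩
    refine ⟨Submodule.smul_mem _ c hF, fun z hz hz' => ?_⟩
    simp only [Pi.smul_apply, smul_eq_mul]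
    rw [hF1 z hz hz']
    ring

/-- The Fourier coefficient `∫_w^{w+1} F(z) e^{-2 π i n z} dz`, along the horizontal segment
from `w` to `w + 1`. For `F ∈ Hol(S/ℤ)` on a horizontal strip `S` it does not depend on
`w ∈ S`, and it is the coefficient of `x^n` in the Fourier expansion of `F` in `S`. -/
def fourierCoefAt (F : ℂ → ℂ) (w : ℂ) (n : ℤ) : ℂ :=
  ∫ t in (0 : ℝ)..1, F (w + t) * ex (w + t) ^ (-n)

/-- `F` is the canonical vector `[f; k]` of `T_{H⁻}(f)`, for a polynomial `f` of degree `d` in `x`: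
an element of `T_{H⁻}(f)` whose Fourier expansion in `H⁻` has coefficient of `x^j` equal
to `1` for `j = k` and to `0` for the other `j ∈ {0, …, d - 1}`. -/
def IsCanonicalVec (τ : ℂ) (f : ℂ → ℂ) (d : ℕ) (k : Fin d) (F : ℂ → ℂ) : Prop :=
  F ∈ TSpace τ lowerHalf f ∧
    ∀ j : Fin d, ∀ w ∈ lowerHalf, fourierCoefAt F w (j : ℕ) = if j = k then 1 else 0

/-- `M` is a meromorphic function on `ℂ` that extends `F` from the domain `D`. -/
def IsMeromorphicContinuation (D : Set ℂ) (F M : ℂ → ℂ) : Prop :=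
  MeromorphicOn M Set.univ ∧ Set.EqOn M F D

/-- The function `q x² - x` of `z`. -/
def rrFactor (q : ℂ) (z : ℂ) : ℂ := q * ex z ^ 2 - ex z

/-- `[-q x⁵; 1] + [-q x⁵; 2]`. -/
def septVec₀ (q : ℂ) (z : ℂ) : ℂ := monomialVec q (-q) 5 1 z + monomialVec q (-q) 5 2 z

/-- `[-q x⁵; 0] + [-q x⁵; 3]`. -/
def septVec₁ (q : ℂ) (z : ℂ) : ℂ := monomialVec q (-q) 5 0 z + monomialVec q (-q) 5 3 z

/-- `T_ℂ(-q x⁵) ∩ S_ℂ(x³)`. -/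
def septSpace (q τ : ℂ) : Submodule ℂ (ℂ → ℂ) :=
  TSpace τ Set.univ (fun z => -q * ex z ^ 5) ⊓ SSpace Set.univ (fun z => ex z ^ 3)

/-- The septuple product `(q; q) ⟨x; q⟩ ⟨q x²; q²⟩ ⟨x²; q²⟩`. -/
def septProduct (q : ℂ) (z : ℂ) : ℂ :=
  qProd q q * thetaProd (ex z) q * thetaProd (q * ex z ^ 2) (q ^ 2) * thetaProd (ex z ^ 2) (q ^ 2)

/-- The product `(q; q) ⟨x; q⟩ (q x; q)`. -/
def rrProduct (q : ℂ) (z : ℂ) : ℂ :=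
  qProd q q * thetaProd (ex z) q * qProd (q * ex z) q

/-- The septuple product identity. -/
def SeptupleIdentity (q : ℂ) : Prop :=
  ∀ z : ℂ, septProduct q z =
    -(septVec₀ q z / thetaProd (q ^ 2) (q ^ 5)) + septVec₁ q z / thetaProd q (q ^ 5)

/-- The two-variable Rogers–Ramanujan statement for `E₀ = [q x² - x; 0]`, `E₁ = [q x² - x; 1]`:
in `H⁻`, the product `(q; q) ⟨x; q⟩ (q x; q)` equals
`∑_{m ∈ ℤ, n ≥ 0} q^{m(m-1)/2 + (n+1)n/2} / (q; q)_n (-x)^{m+n}` and also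
`E₀ / ⟨q²; q⁵⟩ - E₁ / ⟨q; q⁵⟩`. -/
def TwoVarRogersRamanujan (q : ℂ) (E₀ E₁ : ℂ → ℂ) : Prop :=
  ∀ z ∈ lowerHalf,
    HasSum (fun p : ℤ × ℕ =>
        q ^ (p.1 * (p.1 - 1) / 2 + ((p.2 : ℤ) + 1) * (p.2 : ℤ) / 2) / qProdFin q q p.2 *
          (-ex z) ^ (p.1 + (p.2 : ℤ)))
      (rrProduct q z) ∧
    rrProduct q z = E₀ z / thetaProd (q ^ 2) (q ^ 5) - E₁ z / thetaProd q (q ^ 5)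

end

open Filter Topology

/-! ### Infinite products -/

section QProducts

variable {q : ℂ}

/-! For k = 0, 1 put K_k = [q x²; k], with Fourier coefficients κ_n, and R_k = K_k / (1/x; q) on the
lower half-plane (`rrVec`). As q x² - x = q x² (1 - 1/(q x)), R_k lies in T_{H⁻}(q x² - x). There
the functional equation is a recursion of order two for the Fourier coefficients, so the
coefficients of 1 and x determine a function. The dimension is thus at most two. It equals two
because R_0 and R_1 are independent, and the canonical basis is dual to these two coefficients.

The quotient Q = ⟨x²; q⟩ / ⟨x; q⟩ (`quintProd`) is entire, and R_k ⟨x²; q⟩ / (q x; q) = -x Q K_k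
lies in T_ℂ(-q x⁵) ∩ S_ℂ(x³), where the coefficients of x and 1 again determine a function.
Proportionality of the bases therefore amounts to two equalities of coefficients
(`fourierCoefAt_rrVec`): Q K_k and R_k have the same coefficient of 1, and the coefficient of 1/x in
Q K_k is that of x in R_k. Linearity then gives `mul_thetaProd_of_mem_TSpace`.

By Euler's expansion, the coefficients of R_k are ∑ κ_m / (q; q)_m and ∑ κ_{m+1} / (q; q)_m. Those
of Q K_k are ∑ κ_n Q_{-n} and ∑ κ_n Q_{-n-1}. A Bailey transform links the two kinds
(`hasSum_theta_coef_mul_rogersSum`). Cauchy's identity turns the bilateral sums into sums of κ_m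
times finite sums of coefficients of Q, and the symmetries of Q collapse the finite sums
(`rogersSum_quintuple`). The normalisation Q_0 = 1 / (q; q) comes from the triple product.

Since Π₇ (q x; q) = Π ⟨x²; q⟩, the proportionality and the identity theorem carry expansions of Π₇
to expansions of Π and back. The double series for Π is the triple product times Euler's series and
holds unconditionally, so only the choice of a₀, a₁ remains for the last equivalence. Neither of the
two equivalent identities is proved here. -/

lemma summable_norm_pow_mul (hq : ‖q‖ < 1) (a : ℂ) : Summable fun n : ℕ => ‖-(q ^ n * a)‖ := by
  simp only [norm_neg, norm_mul, norm_pow]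
  exact (summable_geometric_of_lt_one (norm_nonneg _) hq).mul_right _

lemma multipliable_qProd (hq : ‖q‖ < 1) (a : ℂ) : Multipliable fun n : ℕ => 1 - q ^ n * a := by
  simpa [sub_eq_add_neg] using multipliable_one_add_of_summable (summable_norm_pow_mul hq a)

lemma tendsto_qProd (hq : ‖q‖ < 1) (a : ℂ) :
    Tendsto (fun n => ∏ k ∈ Finset.range n, (1 - q ^ k * a)) atTop (𝓝 (qProd a q)) :=
  (multipliable_qProd hq a).hasProd.tendsto_prod_nat

lemma qProd_ne_zero (hq : ‖q‖ < 1) {a : ℂ} (ha : ∀ n : ℕ, q ^ n * a ≠ 1) : qProd a q ≠ 0 := by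
  have := tprod_one_add_ne_zero_of_summable (f := fun n : ℕ => -(q ^ n * a))
    (fun n => by rw [← sub_eq_add_neg, sub_ne_zero]; exact (ha n).symm) (summable_norm_pow_mul hq a)
  simpa [qProd, sub_eq_add_neg] using this

lemma qProd_ne_zero_of_norm_lt_one (hq : ‖q‖ < 1) {a : ℂ} (ha : ‖a‖ < 1) : qProd a q ≠ 0 := by
  refine qProd_ne_zero hq fun n h => ?_
  have h1 := congrArg norm h
  rw [norm_mul, norm_pow, norm_one] at h1
  have h2 : ‖q‖ ^ n ≤ 1 := pow_le_one₀ (norm_nonneg _) hq.le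
  nlinarith [norm_nonneg a, norm_nonneg q]

lemma qProd_eq_mul (hq : ‖q‖ < 1) (a : ℂ) : qProd a q = (1 - a) * qProd (q * a) q := by
  refine tendsto_nhds_unique ((tendsto_add_atTop_iff_nat 1).2 (tendsto_qProd hq a)) ?_
  refine ((tendsto_qProd hq (q * a)).const_mul (1 - a)).congr fun n => ?_
  rw [Finset.prod_range_succ', mul_comm]
  simp [pow_succ, mul_assoc]

lemma norm_pow_lt_one {q : ℂ} (hq : ‖q‖ < 1) {k : ℕ} (hk : k ≠ 0) : ‖q ^ k‖ < 1 := by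
  rw [norm_pow]; exact pow_lt_one₀ (norm_nonneg _) hq hk

lemma qProd_mul_qProd_neg (hq : ‖q‖ < 1) (a : ℂ) :
    qProd a q * qProd (-a) q = qProd (a ^ 2) (q ^ 2) := by
  refine tendsto_nhds_unique ((tendsto_qProd hq a).mul (tendsto_qProd hq (-a))) ?_
  refine (tendsto_qProd (norm_pow_lt_one hq two_ne_zero) (a ^ 2)).congr fun n => ?_
  rw [← Finset.prod_mul_distrib]
  refine Finset.prod_congr rfl fun k _ => ?_
  ring

lemma qProd_eq_even_mul_odd (hq : ‖q‖ < 1) (a : ℂ) :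
    qProd a q = qProd a (q ^ 2) * qProd (q * a) (q ^ 2) := by
  have h2 := norm_pow_lt_one hq two_ne_zero
  refine tendsto_nhds_unique ((tendsto_qProd hq a).comp (tendsto_id.const_mul_atTop' two_pos))
    (((tendsto_qProd h2 a).mul (tendsto_qProd h2 (q * a))).congr fun n => ?_)
  simp only [Function.comp, id]
  induction n with
  | zero => simp
  | succ n ih =>
    rw [show 2 * (n + 1) = 2 * n + 1 + 1 by ring, Finset.prod_range_succ _ (2 * n + 1),
      Finset.prod_range_succ _ (2 * n), ← ih, Finset.prod_range_succ, Finset.prod_range_succ]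
    ring

lemma qProd_eq_mul_mod_three (hq : ‖q‖ < 1) (a : ℂ) :
    qProd a q = qProd a (q ^ 3) * qProd (q * a) (q ^ 3) * qProd (q ^ 2 * a) (q ^ 3) := by
  have h3 := norm_pow_lt_one hq three_ne_zero
  refine tendsto_nhds_unique ((tendsto_qProd hq a).comp (tendsto_id.const_mul_atTop' three_pos))
    ((((tendsto_qProd h3 a).mul (tendsto_qProd h3 (q * a))).mul
      (tendsto_qProd h3 (q ^ 2 * a))).congr fun n => ?_)
  simp only [Function.comp, id]
  induction n with
  | zero => simp
  | succ n ih =>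
    rw [show 3 * (n + 1) = 3 * n + 1 + 1 + 1 by ring, Finset.prod_range_succ _ (3 * n + 1 + 1),
      Finset.prod_range_succ _ (3 * n + 1), Finset.prod_range_succ _ (3 * n), ← ih,
      Finset.prod_range_succ, Finset.prod_range_succ, Finset.prod_range_succ]
    ring

lemma thetaProd_q_div {q : ℂ} (hq0 : q ≠ 0) (y : ℂ) : thetaProd (q / y) q = thetaProd y q := by
  rw [thetaProd, thetaProd, div_div_cancel₀ hq0, mul_comm]

lemma thetaProd_q_mul (hq : ‖q‖ < 1) (hq0 : q ≠ 0) {y : ℂ} (hy : y ≠ 0) :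
    thetaProd y q = -y * thetaProd (q * y) q := by
  rw [thetaProd, thetaProd, qProd_eq_mul hq y, show q / (q * y) = 1 / y by field_simp,
    qProd_eq_mul hq (1 / y), mul_one_div]
  field_simp
  ring

lemma thetaProd_inv (hq : ‖q‖ < 1) (hq0 : q ≠ 0) {y : ℂ} (hy : y ≠ 0) :
    thetaProd y⁻¹ q = -y⁻¹ * thetaProd y q := by
  rw [thetaProd_q_mul hq hq0 (inv_ne_zero hy), ← div_eq_mul_inv, thetaProd_q_div hq0]

/-! ### The finite products `(q; q)_n` -/

lemma qProdFin_succ (a q : ℂ) (n : ℕ) :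
    qProdFin a q (n + 1) = qProdFin a q n * (1 - a * q ^ n) := Finset.prod_range_succ _ _

lemma one_sub_pow_succ_ne_zero (hq : ‖q‖ < 1) (n : ℕ) : 1 - q * q ^ n ≠ 0 := by
  intro h
  have := norm_pow_lt_one hq n.succ_ne_zero
  rw [pow_succ', ← sub_eq_zero.1 h] at this
  simp at this

lemma qProdFin_self_ne_zero (hq : ‖q‖ < 1) (n : ℕ) : qProdFin q q n ≠ 0 :=
  Finset.prod_ne_zero_iff.2 fun k _ => one_sub_pow_succ_ne_zero hq k

lemma tendsto_qProdFin_self (hq : ‖q‖ < 1) :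
    Tendsto (qProdFin q q) atTop (𝓝 (qProd q q)) := by
  refine (tendsto_qProd hq q).congr fun n => ?_
  simp only [qProdFin, mul_comm]

lemma qProd_self_ne_zero (hq : ‖q‖ < 1) : qProd q q ≠ 0 := qProd_ne_zero_of_norm_lt_one hq hq

lemma exists_norm_inv_qProdFin_le (hq : ‖q‖ < 1) :
    ∃ C : ℝ, 0 ≤ C ∧ ∀ n, ‖(qProdFin q q n)⁻¹‖ ≤ C := by
  obtain ⟨C, hC⟩ := ((tendsto_qProdFin_self hq).inv₀ (qProd_self_ne_zero hq)).norm.bddAbove_range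
  have h : ∀ n, ‖(qProdFin q q n)⁻¹‖ ≤ C := fun n => hC ⟨n, rfl⟩
  exact ⟨C, (norm_nonneg _).trans (h 0), h⟩

/-! ### Euler's expansions -/

lemma summable_norm_pow_div_qProdFin (hq : ‖q‖ < 1) {y : ℂ} (hy : ‖y‖ < 1) :
    Summable fun m : ℕ => ‖y ^ m / qProdFin q q m‖ := by
  obtain ⟨C, -, hC⟩ := exists_norm_inv_qProdFin_le hq
  refine Summable.of_nonneg_of_le (fun _ => norm_nonneg _) (fun m => ?_)
    ((summable_geometric_of_lt_one (norm_nonneg _) hy).mul_right C)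
  rw [div_eq_mul_inv, norm_mul, norm_pow]
  exact mul_le_mul_of_nonneg_left (hC m) (by positivity)

lemma tendsto_pow_mul (hq : ‖q‖ < 1) (y : ℂ) : Tendsto (fun n => q ^ n * y) atTop (𝓝 0) := by
  simpa using (tendsto_pow_atTop_nhds_zero_of_norm_lt_one hq).mul_const y

/-- Supplies the limit F(qⁿ y) → F(0) that ends both proofs of Euler's expansions. -/
lemma tendsto_powerSeries_geometric (hq : ‖q‖ < 1) {c : ℕ → ℂ} {y : ℂ}
    (hc : Summable fun m => ‖c m * y ^ m‖) :
    Tendsto (fun n : ℕ => ∑' m, c m * (q ^ n * y) ^ m) atTop (𝓝 (c 0)) := by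
  have h0 : c 0 = ∑' m : ℕ, c m * 0 ^ m := by
    rw [tsum_eq_single 0 (fun m hm => by simp [hm])]; simp
  rw [h0]
  refine tendsto_tsum_of_dominated_convergence hc (fun m => ?_) (Eventually.of_forall fun n m => ?_)
  · exact ((tendsto_pow_mul hq y).pow m).const_mul (c m)
  · rw [mul_pow, norm_mul, norm_mul, norm_mul]
    refine mul_le_mul_of_nonneg_left ?_ (norm_nonneg _)
    refine mul_le_of_le_one_left (norm_nonneg _) ?_
    rw [norm_pow, norm_pow]
    exact pow_le_one₀ (by positivity) (pow_le_one₀ (norm_nonneg _) hq.le)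

/-- Euler's expansion of `1 / (y; q)`. -/
lemma hasSum_inv_qProd (hq : ‖q‖ < 1) {y : ℂ} (hy : ‖y‖ < 1) :
    HasSum (fun m : ℕ => y ^ m / qProdFin q q m) (qProd y q)⁻¹ := by
  set F : ℂ → ℂ := fun y => ∑' m : ℕ, (qProdFin q q m)⁻¹ * y ^ m with hF
  have hs : ∀ y : ℂ, ‖y‖ < 1 → Summable fun m : ℕ => (qProdFin q q m)⁻¹ * y ^ m := fun y hy => by
    simpa [div_eq_mul_inv, mul_comm] using (summable_norm_pow_div_qProdFin hq hy).of_norm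
  have hlt : ∀ n : ℕ, ‖q ^ n * y‖ < 1 := fun n => by
    rw [norm_mul, norm_pow]
    exact (mul_le_of_le_one_left (norm_nonneg _) (pow_le_one₀ (norm_nonneg _) hq.le)).trans_lt hy
  -- The q-difference equation of 1 / (y; q). Iterating it collects the first n factors of (y; q)
  -- and leaves F(qⁿ y), which tends to F(0) = 1.
  have hrec : ∀ y : ℂ, ‖y‖ < 1 → ‖q * y‖ < 1 → (1 - y) * F y = F (q * y) := by
    intro y hy hqy
    have h1 := hs y hy
    have h2 := hs _ hqy
    have h3 : F y - F (q * y) = y * F y := by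
      simp only [hF]
      rw [← h1.tsum_sub h2, ← tsum_mul_left, (h1.sub h2).tsum_eq_zero_add]
      simp only [pow_zero, sub_self, zero_add]
      refine tsum_congr fun m => ?_
      have := qProdFin_self_ne_zero hq m
      have := one_sub_pow_succ_ne_zero hq m
      rw [qProdFin_succ]
      field_simp
      ring
    linear_combination h3
  have hit : ∀ n : ℕ, (∏ k ∈ Finset.range n, (1 - q ^ k * y)) * F y = F (q ^ n * y) := by
    intro n
    induction n with
    | zero => simp
    | succ n ih =>
      have h := hlt (n + 1)
      rw [pow_succ', mul_assoc] at h
      rw [Finset.prod_range_succ, mul_right_comm, ih, mul_comm, hrec _ (hlt n) h, pow_succ',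
        mul_assoc]
  have hlim : qProd y q * F y = 1 := by
    refine tendsto_nhds_unique ((tendsto_qProd hq y).mul_const (F y)) ?_
    simp only [hit]
    have := tendsto_powerSeries_geometric hq (c := fun m => (qProdFin q q m)⁻¹) (y := y)
      (hs y hy).norm
    simpa [hF, qProdFin] using this
  rw [← eq_inv_of_mul_eq_one_right hlim]
  simpa [hF, div_eq_mul_inv, mul_comm] using (hs y hy).hasSum

/-- The coefficient of `y^m` in `(y; q)`. -/
noncomputable def eulerCoef (q : ℂ) (m : ℕ) : ℂ := (-1) ^ m * q ^ m.choose 2 / qProdFin q q m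

lemma eulerCoef_succ (hq : ‖q‖ < 1) (m : ℕ) :
    eulerCoef q (m + 1) * (1 - q * q ^ m) = -(q ^ m * eulerCoef q m) := by
  have := qProdFin_self_ne_zero hq m
  have := one_sub_pow_succ_ne_zero hq m
  have hc : (m + 1).choose 2 = m + m.choose 2 := by
    rw [Nat.choose_succ_succ' m 1, Nat.choose_one_right]
  rw [eulerCoef, eulerCoef, qProdFin_succ, hc, pow_add, pow_succ]
  field_simp
  ring

lemma summable_norm_eulerCoef (hq : ‖q‖ < 1) (y : ℂ) :
    Summable fun m : ℕ => ‖eulerCoef q m * y ^ m‖ := by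
  obtain ⟨C, -, hC⟩ := exists_norm_inv_qProdFin_le hq
  have h : Summable fun m : ℕ => ‖q ^ m.choose 2 * y ^ m‖ := by
    refine Summable.norm (summable_of_ratio_norm_eventually_le (r := 1 / 2) (by norm_num) ?_)
    have h0 := (tendsto_pow_mul hq y).norm.eventually_lt_const (u := 1 / 2) (by simp)
    filter_upwards [h0] with m hm
    have hc : (m + 1).choose 2 = m + m.choose 2 := by
      rw [Nat.choose_succ_succ' m 1, Nat.choose_one_right]
    rw [hc, pow_add, pow_succ, show q ^ m * q ^ m.choose 2 * (y ^ m * y)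
      = q ^ m * y * (q ^ m.choose 2 * y ^ m) by ring, norm_mul]
    exact mul_le_mul_of_nonneg_right hm.le (norm_nonneg _)
  refine Summable.of_nonneg_of_le (fun _ => norm_nonneg _) (fun m => ?_) (h.mul_right C)
  rw [eulerCoef, div_eq_mul_inv, show (-1) ^ m * q ^ m.choose 2 * (qProdFin q q m)⁻¹ * y ^ m
    = (-1) ^ m * ((q ^ m.choose 2 * y ^ m) * (qProdFin q q m)⁻¹) by ring, norm_mul, norm_pow,
    norm_neg, norm_one, one_pow, one_mul, norm_mul]
  exact mul_le_mul_of_nonneg_left (hC m) (norm_nonneg _)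

/-- Euler's expansion of `(y; q)`. -/
lemma hasSum_qProd (hq : ‖q‖ < 1) (y : ℂ) :
    HasSum (fun m : ℕ => eulerCoef q m * y ^ m) (qProd y q) := by
  set F : ℂ → ℂ := fun y => ∑' m : ℕ, eulerCoef q m * y ^ m with hF
  have hs : ∀ y : ℂ, Summable fun m : ℕ => eulerCoef q m * y ^ m := fun y =>
    (summable_norm_eulerCoef hq y).of_norm
  have hrec : ∀ y : ℂ, F y = (1 - y) * F (q * y) := by
    intro y
    have h1 := hs y
    have h2 := hs (q * y)
    have h3 : F y - F (q * y) = -y * F (q * y) := by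
      simp only [hF]
      rw [← h1.tsum_sub h2, ← tsum_mul_left, (h1.sub h2).tsum_eq_zero_add]
      simp only [pow_zero, sub_self, zero_add]
      refine tsum_congr fun m => ?_
      linear_combination y ^ (m + 1) * eulerCoef_succ hq m
    linear_combination h3
  have hit : ∀ n : ℕ, F y = (∏ k ∈ Finset.range n, (1 - q ^ k * y)) * F (q ^ n * y) := by
    intro n
    induction n with
    | zero => simp
    | succ n ih =>
      rw [Finset.prod_range_succ, mul_assoc, pow_succ', mul_assoc q, ← hrec, ih]
  have hlim : F y = qProd y q := by
    refine tendsto_nhds_unique ((tendsto_const_nhds (f := atTop)).congr hit) ?_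
    have := (tendsto_qProd hq y).mul
      (tendsto_powerSeries_geometric hq (summable_norm_eulerCoef hq y))
    simpa [hF, eulerCoef, qProdFin] using this
  rw [← hlim]
  exact (hs y).hasSum

/-- Euler's series converges everywhere, and on the ball of radius ‖y‖ + 1 its terms are dominated
by those at the real point ‖y‖ + 1. -/
lemma differentiable_qProd (hq : ‖q‖ < 1) : Differentiable ℂ fun y => qProd y q := by
  have h : (fun y => qProd y q) = fun y => ∑' m : ℕ, eulerCoef q m * y ^ m :=
    funext fun y => (hasSum_qProd hq y).tsum_eq.symm
  rw [h]
  intro y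
  refine (Complex.differentiableOn_tsum_of_summable_norm (U := Metric.ball 0 (‖y‖ + 1))
    (summable_norm_eulerCoef hq ((‖y‖ + 1 : ℝ) : ℂ)) (fun m => by fun_prop) Metric.isOpen_ball
    fun m w hw => ?_).differentiableAt (Metric.isOpen_ball.mem_nhds (by simp))
  rw [norm_mul, norm_mul, norm_pow, norm_pow, Complex.norm_real,
    Real.norm_of_nonneg (by positivity)]
  have : ‖w‖ < ‖y‖ + 1 := by simpa using hw
  gcongr

end QProducts

/-! ### Cauchy's identity and the Jacobi triple product -/

section TripleProduct

variable {q : ℂ}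

/-- Uniformity in d is the point: it permits dominated convergence as d → ∞ and, in the Bailey
transform, summability over all pairs. -/
lemma exists_norm_cauchyTerm_le (hq : ‖q‖ < 1) :
    ∃ C : ℝ, ∀ d b : ℕ, ‖q ^ (b ^ 2 + b * d) / (qProdFin q q b * qProdFin q q (b + d))‖ ≤
      ‖q‖ ^ b * C := by
  obtain ⟨C, hC0, hC⟩ := exists_norm_inv_qProdFin_le hq
  refine ⟨C * C, fun d b => ?_⟩
  rw [div_eq_mul_inv, mul_inv, norm_mul, norm_mul, norm_pow]
  refine mul_le_mul (pow_le_pow_of_le_one (norm_nonneg _) hq.le ?_)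
    (mul_le_mul (hC _) (hC _) (norm_nonneg _) hC0) (by positivity) (by positivity)
  exact (Nat.le_self_pow two_ne_zero b).trans (Nat.le_add_right _ _)

lemma summable_norm_cauchyTerm (hq : ‖q‖ < 1) (d : ℕ) :
    Summable fun b : ℕ => ‖q ^ (b ^ 2 + b * d) / (qProdFin q q b * qProdFin q q (b + d))‖ := by
  obtain ⟨C, hC⟩ := exists_norm_cauchyTerm_le hq
  exact Summable.of_nonneg_of_le (fun _ => norm_nonneg _) (hC d)
    ((summable_geometric_of_lt_one (norm_nonneg q) hq).mul_right C)

lemma tendsto_tsum_cauchyTerm (hq : ‖q‖ < 1) :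
    Tendsto (fun d : ℕ => ∑' b : ℕ, q ^ (b ^ 2 + b * d) / (qProdFin q q b * qProdFin q q (b + d)))
      atTop (𝓝 (qProd q q)⁻¹) := by
  obtain ⟨C, hC⟩ := exists_norm_cauchyTerm_le hq
  have h0 : (qProd q q)⁻¹ = ∑' b : ℕ, if b = 0 then (qProd q q)⁻¹ else 0 := by
    rw [tsum_ite_eq]
  rw [h0]
  refine tendsto_tsum_of_dominated_convergence (bound := fun b => ‖q‖ ^ b * C)
    ((summable_geometric_of_lt_one (norm_nonneg q) hq).mul_right C) (fun b => ?_)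
    (Eventually.of_forall hC)
  have h1 : Tendsto (fun d => (qProdFin q q (b + d))⁻¹) atTop (𝓝 (qProd q q)⁻¹) := by
    simp only [add_comm b]
    exact ((tendsto_add_atTop_iff_nat b).2 (tendsto_qProdFin_self hq)).inv₀
      (qProd_self_ne_zero hq)
  rcases eq_or_ne b 0 with rfl | hb
  · simpa [qProdFin] using h1
  · have h2 : Tendsto (fun d : ℕ => q ^ (b ^ 2) * (q ^ b) ^ d) atTop (𝓝 (q ^ (b ^ 2) * 0)) :=
      (tendsto_pow_atTop_nhds_zero_of_norm_lt_one (norm_pow_lt_one hq hb)).const_mul _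
    have h3 := (h2.mul_const (qProdFin q q b)⁻¹).mul h1
    rw [if_neg hb]
    simp only [mul_zero, zero_mul] at h3
    refine h3.congr fun d => ?_
    rw [pow_add, pow_mul q b d, div_eq_mul_inv, mul_inv]
    ring

/-- With all multiples of f (d + 1) moved to the left, the b = 0 terms cancel, and the term at b + 1
on the left is the term at b of q^(d+1) f (d + 2). -/
lemma tsum_cauchyTerm_sub (hq : ‖q‖ < 1) {f : ℕ → ℂ}
    (hf : f = fun d : ℕ => ∑' b : ℕ, q ^ (b ^ 2 + b * d) / (qProdFin q q b * qProdFin q q (b + d)))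
    (d : ℕ) : f d - f (d + 1) = q ^ (d + 1) * (f (d + 2) - f (d + 1)) := by
  have h (d : ℕ) := (summable_norm_cauchyTerm hq d).of_norm
  have key : f d - f (d + 1) + q ^ (d + 1) * f (d + 1) = q ^ (d + 1) * f (d + 2) := by
    simp only [hf]
    rw [← (h d).tsum_sub (h (d + 1)), ← tsum_mul_left, ← tsum_mul_left,
      ← ((h d).sub (h (d + 1))).tsum_add ((h (d + 1)).mul_left _),
      (((h d).sub (h (d + 1))).add ((h (d + 1)).mul_left _)).tsum_eq_zero_add]
    have hz : q ^ (0 ^ 2 + 0 * d) / (qProdFin q q 0 * qProdFin q q (0 + d)) -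
        q ^ (0 ^ 2 + 0 * (d + 1)) / (qProdFin q q 0 * qProdFin q q (0 + (d + 1))) +
        q ^ (d + 1) * (q ^ (0 ^ 2 + 0 * (d + 1)) /
          (qProdFin q q 0 * qProdFin q q (0 + (d + 1)))) = 0 := by
      have h1 := qProdFin_self_ne_zero hq d
      have h2 := one_sub_pow_succ_ne_zero hq d
      simp only [zero_add, qProdFin_succ]
      simp only [qProdFin, Finset.range_zero, Finset.prod_empty] at *
      field_simp
      ring
    rw [hz, zero_add]
    refine tsum_congr fun b => ?_
    have h1 := qProdFin_self_ne_zero hq b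
    have h2 := one_sub_pow_succ_ne_zero hq b
    have h3 := qProdFin_self_ne_zero hq (b + 1 + d)
    have h4 := one_sub_pow_succ_ne_zero hq (b + 1 + d)
    rw [show b + (d + 2) = b + 1 + d + 1 by ring, show b + 1 + (d + 1) = b + 1 + d + 1 by ring,
      qProdFin_succ q q b, qProdFin_succ q q (b + 1 + d)]
    field_simp
    ring
  linear_combination key

/-- Cauchy's identity. By the recursion ‖f d - f (d + 1)‖ is nondecreasing in d, yet it tends to 0
because f converges. So f is constant and equal to its limit. -/
lemma tsum_cauchyTerm (hq : ‖q‖ < 1) (d : ℕ) :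
    ∑' b : ℕ, q ^ (b ^ 2 + b * d) / (qProdFin q q b * qProdFin q q (b + d)) = (qProd q q)⁻¹ := by
  set f : ℕ → ℂ := fun d => ∑' b : ℕ, q ^ (b ^ 2 + b * d) / (qProdFin q q b * qProdFin q q (b + d))
    with hf
  have hlim : Tendsto f atTop (𝓝 (qProd q q)⁻¹) := tendsto_tsum_cauchyTerm hq
  have hle : ∀ d, ‖f d - f (d + 1)‖ ≤ ‖f (d + 1) - f (d + 2)‖ := fun d => by
    rw [tsum_cauchyTerm_sub hq hf d, norm_mul, norm_sub_rev (f (d + 1))]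
    exact mul_le_of_le_one_left (norm_nonneg _) (norm_pow_lt_one hq d.succ_ne_zero).le
  have hmono : Monotone fun d => ‖f d - f (d + 1)‖ := monotone_nat_of_le_succ hle
  have hdiff : Tendsto (fun d => ‖f d - f (d + 1)‖) atTop (𝓝 0) := by
    simpa using (hlim.sub ((tendsto_add_atTop_iff_nat 1).2 hlim)).norm
  have hzero : ∀ d, f (d + 1) = f d := fun d => by
    have := norm_le_zero_iff.1 (hmono.ge_of_tendsto hdiff d)
    exact (sub_eq_zero.1 this).symm
  have hconst : ∀ n, f (n + d) = f d := fun n => by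
    induction n with
    | zero => simp
    | succ n ih => rw [show n + 1 + d = n + d + 1 by ring, hzero, ih]
  refine tendsto_nhds_unique (tendsto_const_nhds.congr fun n => (hconst n).symm)
    ((tendsto_add_atTop_iff_nat d).2 hlim)

/-- Pairs `(a, b)` of natural numbers, parametrised by `a - b` and `min a b`. -/
def diffMinEquiv : ℤ × ℕ ≃ ℕ × ℕ where
  toFun p := (p.2 + p.1.toNat, p.2 + (-p.1).toNat)
  invFun p := ((p.1 : ℤ) - p.2, min p.1 p.2)
  left_inv p := by ext <;> simp; omega
  right_inv p := by ext <;> simp <;> omega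

lemma Int.two_mul_mul_sub_one_ediv_two (n : ℤ) : 2 * (n * (n - 1) / 2) = n * (n - 1) :=
  Int.mul_ediv_cancel' (Int.even_mul_pred_self n).two_dvd

lemma Nat.two_mul_choose_two_cast (n : ℕ) : 2 * (n.choose 2 : ℤ) = n * (n - 1) := by
  induction n with
  | zero => simp
  | succ n ih =>
    rw [Nat.choose_succ_succ' n 1, Nat.choose_one_right]
    push_cast
    linear_combination ih

lemma hasSum_cauchyTerm (hq : ‖q‖ < 1) (n : ℤ) :
    HasSum (fun b : ℕ => q ^ (b ^ 2 + b * n.natAbs) /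
      (qProdFin q q (b + n.toNat) * qProdFin q q (b + (-n).toNat))) (qProd q q)⁻¹ := by
  rw [← tsum_cauchyTerm hq n.natAbs]
  refine (summable_norm_cauchyTerm hq n.natAbs).of_norm.hasSum.congr_fun fun b => ?_
  obtain ⟨d, rfl | rfl⟩ := n.eq_nat_or_neg
  · simp [mul_comm]
  · simp

/-- For exponents of difference n and minimum b, the product of Euler terms splits into the n-th
term of the triple product series and a Cauchy term. -/
lemma eulerCoef_mul_eulerCoef (hq0 : q ≠ 0) {y : ℂ} (hy : y ≠ 0) (n : ℤ) (b : ℕ) :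
    eulerCoef q (b + n.toNat) * y ^ (b + n.toNat) *
        (eulerCoef q (b + (-n).toNat) * (q / y) ^ (b + (-n).toNat)) =
      (-1) ^ n * q ^ (n * (n - 1) / 2) * y ^ n * (q ^ (b ^ 2 + b * n.natAbs) /
      (qProdFin q q (b + n.toNat) * qProdFin q q (b + (-n).toNat))) := by
  have hs : (-1 : ℂ) ^ (b + n.toNat) * (-1) ^ (b + (-n).toNat) = (-1) ^ n := by
    obtain ⟨d, rfl | rfl⟩ := n.eq_nat_or_neg
    · simp only [Int.toNat_natCast, Int.toNat_neg_natCast, zpow_natCast, pow_add, pow_zero]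
      rw [mul_right_comm, mul_one, ← mul_pow]; simp
    · simp only [Int.toNat_natCast, neg_neg, Int.toNat_neg_natCast, zpow_neg, zpow_natCast,
        pow_add, pow_zero, ← inv_pow]
      rw [mul_one, ← mul_assoc, ← mul_pow]; norm_num
  have hyy : y ^ (b + n.toNat) * (q / y) ^ (b + (-n).toNat) = y ^ n * q ^ (b + (-n).toNat) := by
    rw [div_pow, ← zpow_natCast y, ← zpow_natCast y, mul_div_left_comm, ← zpow_sub₀ hy, mul_comm]
    congr 2
    push_cast
    omega
  have hqq : q ^ (b + n.toNat).choose 2 * q ^ (b + (-n).toNat).choose 2 * q ^ (b + (-n).toNat) =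
      q ^ (n * (n - 1) / 2) * q ^ (b ^ 2 + b * n.natAbs) := by
    rw [← pow_add, ← pow_add, ← zpow_natCast, ← zpow_natCast, ← zpow_add₀ hq0]
    congr 1
    have h1 := Int.two_mul_mul_sub_one_ediv_two n
    have h2 := Nat.two_mul_choose_two_cast (b + n.toNat)
    have h3 := Nat.two_mul_choose_two_cast (b + (-n).toNat)
    refine mul_left_cancel₀ (two_ne_zero (α := ℤ)) ?_
    push_cast at *
    rw [mul_add, mul_add, mul_add 2 (n * (n - 1) / 2), h1, h2, h3]
    obtain ⟨d, rfl | rfl⟩ := n.eq_nat_or_neg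
    · simp; ring
    · simp; ring
  simp only [eulerCoef]
  rw [div_mul_eq_mul_div, div_mul_eq_mul_div (_ * q ^ (b + (-n).toNat).choose 2), div_mul_div_comm,
    ← mul_div_assoc]
  congr 1
  calc _ = ((-1) ^ (b + n.toNat) * (-1) ^ (b + (-n).toNat)) *
        (q ^ (b + n.toNat).choose 2 * q ^ (b + (-n).toNat).choose 2) *
        (y ^ (b + n.toNat) * (q / y) ^ (b + (-n).toNat)) := by ring
    _ = (-1) ^ n * y ^ n * (q ^ (b + n.toNat).choose 2 * q ^ (b + (-n).toNat).choose 2 *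
        q ^ (b + (-n).toNat)) := by rw [hs, hyy]; ring
    _ = _ := by rw [hqq]; ring

lemma hasSum_thetaProd_prod (hq : ‖q‖ < 1) (y : ℂ) :
    HasSum (fun p : ℕ × ℕ => eulerCoef q p.1 * y ^ p.1 * (eulerCoef q p.2 * (q / y) ^ p.2))
      (thetaProd y q) :=
  HasSum.mul (f := fun m => eulerCoef q m * y ^ m) (g := fun m => eulerCoef q m * (q / y) ^ m)
    (hasSum_qProd hq y) (hasSum_qProd hq (q / y))
    (summable_mul_of_summable_norm (f := fun m => eulerCoef q m * y ^ m)
      (g := fun m => eulerCoef q m * (q / y) ^ m) (summable_norm_eulerCoef hq y)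
      (summable_norm_eulerCoef hq (q / y)))

/-- The Jacobi triple product identity. -/
lemma hasSum_thetaProd (hq : ‖q‖ < 1) (hq0 : q ≠ 0) {y : ℂ} (hy : y ≠ 0) :
    HasSum (fun n : ℤ => (-1) ^ n * q ^ (n * (n - 1) / 2) * y ^ n) (qProd q q * thetaProd y q) := by
  have h := diffMinEquiv.hasSum_iff.2 (hasSum_thetaProd_prod hq y)
  have h2 : HasSum (fun n : ℤ => (-1) ^ n * q ^ (n * (n - 1) / 2) * y ^ n * (qProd q q)⁻¹)
      (thetaProd y q) := by
    -- Pairs of exponents are grouped by their difference n; the sum over the minimum b is Cauchy's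
    -- identity.
    refine h.prod_fiberwise fun n => ?_
    refine ((hasSum_cauchyTerm hq n).mul_left ((-1) ^ n * q ^ (n * (n - 1) / 2) * y ^ n)).congr_fun
      fun b => ?_
    exact eulerCoef_mul_eulerCoef hq0 hy n b
  refine (h2.mul_left (qProd q q)).congr_fun fun n => ?_
  rw [mul_comm (qProd q q), inv_mul_cancel_right₀ (qProd_self_ne_zero hq)]

end TripleProduct

/-! ### The exponential `ex` -/

section Ex

lemma ex_add (z w : ℂ) : ex (z + w) = ex z * ex w := by
  rw [ex, ex, ex, ← Complex.exp_add, mul_add]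

lemma ex_neg (z : ℂ) : ex (-z) = (ex z)⁻¹ := by
  rw [ex, ex, ← Complex.exp_neg, mul_neg]

lemma ex_ne_zero (z : ℂ) : ex z ≠ 0 := Complex.exp_ne_zero _

lemma ex_add_one (z : ℂ) : ex (z + 1) = ex z := by
  rw [ex_add, ex, ex, mul_one, Complex.exp_two_pi_mul_I, mul_one]

lemma ex_zero : ex 0 = 1 := by simp [ex]

lemma norm_ex (z : ℂ) : ‖ex z‖ = Real.exp (-(2 * Real.pi * z.im)) := by
  rw [ex, Complex.norm_exp]
  congr 1
  rw [show (2 * Real.pi * Complex.I * z : ℂ) = ((2 * Real.pi : ℝ) : ℂ) * (z * Complex.I) by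
    push_cast; ring, Complex.re_ofReal_mul]
  simp

lemma norm_ex_add_ofReal (z : ℂ) (t : ℝ) : ‖ex (z + t)‖ = ‖ex z‖ := by
  simp [norm_ex]

lemma one_lt_norm_ex {z : ℂ} (hz : z ∈ lowerHalf) : 1 < ‖ex z‖ := by
  rw [norm_ex, Real.one_lt_exp_iff, neg_pos]
  exact mul_neg_of_pos_of_neg Real.two_pi_pos hz

lemma differentiable_ex : Differentiable ℂ ex := by
  unfold ex; fun_prop

lemma differentiable_ex_zpow (n : ℤ) : Differentiable ℂ fun z => ex z ^ n := fun z =>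
  (differentiable_ex z).zpow (Or.inl (ex_ne_zero z))

lemma continuous_ex_zpow (n : ℤ) : Continuous fun z => ex z ^ n :=
  (differentiable_ex_zpow n).continuous

end Ex

/-! ### Fourier coefficients on horizontal lines -/

section Fourier

/-- A union of horizontal lines that is convex. -/
def IsStrip (D : Set ℂ) : Prop :=
  ∀ z ∈ D, ∀ w ∈ D, ∀ u : ℂ, u.im ∈ Set.uIcc z.im w.im → u ∈ D

lemma isStrip_univ : IsStrip Set.univ := fun _ _ _ _ _ _ => trivial

lemma isStrip_lowerHalf : IsStrip lowerHalf := fun _ hz _ hw _ hu =>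
  (Set.mem_uIcc.1 hu).elim (fun h => h.2.trans_lt hw) (fun h => h.2.trans_lt hz)

lemma IsStrip.add_ofReal {D : Set ℂ} (hD : IsStrip D) {w : ℂ} (hw : w ∈ D) (t : ℝ) : w + t ∈ D :=
  hD w hw w hw _ (by simp)

lemma continuous_add_ofReal {D : Set ℂ} (hD : IsStrip D) {F : ℂ → ℂ} (hF : ContinuousOn F D)
    {w : ℂ} (hw : w ∈ D) : Continuous fun t : ℝ => F (w + t) :=
  hF.comp_continuous (by fun_prop) (hD.add_ofReal hw)

/-- Cauchy's theorem on the rectangle between the two horizontal lines: the vertical sides cancel by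
periodicity. -/
lemma fourierCoefAt_eq_of_mem {D : Set ℂ} (hD : IsStrip D) {F : ℂ → ℂ} (hF : F ∈ HolPer D)
    {w w' : ℂ} (hw : w ∈ D) (hw' : w' ∈ D) (n : ℤ) :
    fourierCoefAt F w n = fourierCoefAt F w' n := by
  obtain ⟨hF1, hF2, -⟩ := hF
  set g : ℂ → ℂ := fun z => F z * ex z ^ (-n) with hg
  have hgd : DifferentiableOn ℂ g D := hF1.mul (differentiable_ex_zpow _).differentiableOn
  have hgp : ∀ z ∈ D, g (z + 1) = g z := fun z hz => by simp only [hg, hF2 z hz, ex_add_one]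
  have hline : ∀ u ∈ D, fourierCoefAt F u n = ∫ t in (0 : ℝ)..1, g (t + u.im * Complex.I) := by
    intro u hu
    have hper : Function.Periodic (fun t : ℝ => g (t + u.im * Complex.I)) 1 := fun t => by
      have := hgp (t + u.im * Complex.I) (hD u hu u hu _ (by simp))
      simp only [Complex.ofReal_add, Complex.ofReal_one]
      rw [← this, add_right_comm]
    have h1 := hper.intervalIntegral_add_eq u.re 0
    rw [zero_add] at h1
    rw [← h1]
    have h2 := intervalIntegral.integral_comp_add_left (a := 0) (b := 1)
      (fun t : ℝ => g (t + u.im * Complex.I)) u.re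
    rw [add_zero] at h2
    rw [← h2, fourierCoefAt]
    congr 1
    ext t
    have : u + t = ((u.re + t : ℝ) : ℂ) + u.im * Complex.I := by
      apply Complex.ext <;> simp
    rw [← this]
  rw [hline w hw, hline w' hw']
  have hrect := Complex.integral_boundary_rect_eq_zero_of_differentiableOn g
    (w.im * Complex.I) (1 + w'.im * Complex.I) (hgd.mono fun u hu => by
      refine hD w hw w' hw' u ?_
      have := hu.2
      simpa using this)
  have hside : ∫ y : ℝ in w.im..w'.im, g (1 + y * Complex.I) =
      ∫ y : ℝ in w.im..w'.im, g (y * Complex.I) := by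
    refine intervalIntegral.integral_congr fun y hy => ?_
    have := hgp (y * Complex.I) (hD w hw w' hw' _ (by simpa using hy))
    rw [add_comm, this]
  simp only [Complex.mul_re, Complex.ofReal_re, Complex.I_re, mul_zero, Complex.ofReal_im,
    Complex.I_im, mul_one, sub_self, Complex.add_re, Complex.one_re, add_zero, Complex.mul_im,
    Complex.add_im, Complex.one_im, zero_add, Complex.ofReal_one, Complex.ofReal_zero, hside]
    at hrect
  linear_combination hrect

/-- On the circle ℝ/ℤ, a continuous function whose Fourier coefficients are summable is the sum of
its Fourier series, here 0. -/
lemma eq_zero_of_fourierCoefAt_eq_zero {F : ℂ → ℂ} {w : ℂ}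
    (hc : Continuous fun t : ℝ => F (w + t)) (hp : ∀ t : ℝ, F (w + t + 1) = F (w + t))
    (h : ∀ n, fourierCoefAt F w n = 0) : F w = 0 := by
  have : Fact ((0 : ℝ) < 1) := ⟨one_pos⟩
  have hper : Function.Periodic (fun t : ℝ => F (w + t)) 1 := fun t => by
    simp only [Complex.ofReal_add, Complex.ofReal_one]
    rw [← hp t, add_assoc]
  let f : C(AddCircle (1 : ℝ), ℂ) := ⟨hper.lift, continuous_quot_lift _ hc⟩
  have hf : ∀ t : ℝ, f (t : AddCircle (1 : ℝ)) = F (w + t) := fun t => hper.lift_coe t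
  have hcoef : fourierCoeff f = 0 := by
    ext n
    rw [fourierCoeff_eq_intervalIntegral f n 0]
    have h1 : ∫ t in (0 : ℝ)..0 + 1, fourier (-n) (t : AddCircle (1 : ℝ)) • f t =
        ex w ^ n * fourierCoefAt F w n := by
      rw [fourierCoefAt, ← intervalIntegral.integral_const_mul, zero_add]
      refine intervalIntegral.integral_congr fun t _ => ?_
      have h2 : fourier (-n) (t : AddCircle (1 : ℝ)) = ex t ^ (-n) := by
        rw [fourier_coe_apply, ex, ← Complex.exp_int_mul]
        congr 1
        push_cast
        ring
      rw [hf, h2, smul_eq_mul, ex_add, mul_zpow, zpow_neg (ex w)]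
      field_simp [zpow_ne_zero n (ex_ne_zero w)]
    rw [h1, h n]
    simp
  have hsum := hasSum_fourier_series_of_summable (f := f) (by rw [hcoef]; exact summable_zero)
  have h0 : f = 0 := by
    refine hsum.unique ?_
    simp only [hcoef, Pi.zero_apply, zero_smul]
    exact hasSum_zero
  have := hf 0
  rw [h0] at this
  simpa using this.symm

lemma fourierCoefAt_add_right (F : ℂ → ℂ) (τ w : ℂ) (n : ℤ) :
    fourierCoefAt (fun z => F (z + τ)) w n = ex τ ^ n * fourierCoefAt F (w + τ) n := by
  rw [fourierCoefAt, fourierCoefAt, ← intervalIntegral.integral_const_mul]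
  refine intervalIntegral.integral_congr fun t _ => ?_
  rw [show w + τ + t = w + t + τ by ring, ex_add _ τ, mul_zpow, zpow_neg (ex τ)]
  field_simp [zpow_ne_zero n (ex_ne_zero τ)]

lemma fourierCoefAt_ex_zpow_mul (F : ℂ → ℂ) (m : ℤ) (w : ℂ) (n : ℤ) :
    fourierCoefAt (fun z => ex z ^ m * F z) w n = fourierCoefAt F w (n - m) := by
  rw [fourierCoefAt, fourierCoefAt]
  refine intervalIntegral.integral_congr fun t _ => ?_
  rw [neg_sub, sub_eq_add_neg, zpow_add₀ (ex_ne_zero _)]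
  ring

lemma fourierCoefAt_const_mul (F : ℂ → ℂ) (c w : ℂ) (n : ℤ) :
    fourierCoefAt (fun z => c * F z) w n = c * fourierCoefAt F w n := by
  rw [fourierCoefAt, fourierCoefAt, ← intervalIntegral.integral_const_mul]
  refine intervalIntegral.integral_congr fun t _ => ?_
  ring

lemma continuous_fourierIntegrand {F : ℂ → ℂ} {w : ℂ} (hF : Continuous fun t : ℝ => F (w + t))
    (n : ℤ) : Continuous fun t : ℝ => F (w + t) * ex (w + t) ^ n :=
  hF.mul ((continuous_ex_zpow n).comp (by fun_prop))

lemma fourierCoefAt_add {F G : ℂ → ℂ} {w : ℂ} (hF : Continuous fun t : ℝ => F (w + t))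
    (hG : Continuous fun t : ℝ => G (w + t)) (n : ℤ) :
    fourierCoefAt (fun z => F z + G z) w n = fourierCoefAt F w n + fourierCoefAt G w n := by
  rw [fourierCoefAt, fourierCoefAt, fourierCoefAt, ← intervalIntegral.integral_add]
  · refine intervalIntegral.integral_congr fun t _ => ?_
    ring
  · exact (continuous_fourierIntegrand hF _).intervalIntegrable _ _
  · exact (continuous_fourierIntegrand hG _).intervalIntegrable _ _

lemma fourierCoefAt_comp_neg {F : ℂ → ℂ} (hF : ∀ z, F (z + 1) = F z) (w : ℂ) (n : ℤ) :
    fourierCoefAt (fun z => F (-z)) w n = fourierCoefAt F (-w) (-n) := by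
  set g : ℝ → ℂ := fun t => F (-w + t) * ex (-w + t) ^ (- -n) with hg
  have hper : Function.Periodic g 1 := fun t => by
    simp only [hg]
    rw [show (-w + ((t + 1 : ℝ) : ℂ)) = -w + t + 1 by push_cast; ring, hF, ex_add_one]
  have h1 : fourierCoefAt (fun z => F (-z)) w n = ∫ t in (0 : ℝ)..1, g (-t) := by
    rw [fourierCoefAt]
    refine intervalIntegral.integral_congr fun t _ => ?_
    simp only [hg]
    rw [show -w + ((-t : ℝ) : ℂ) = -(w + t) by push_cast; ring, ex_neg, inv_zpow', neg_neg]
  have h2 := hper.intervalIntegral_add_eq (-1) 0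
  rw [h1, intervalIntegral.integral_comp_neg, fourierCoefAt]
  simpa [hg] using h2

lemma fourierCoefAt_one (w : ℂ) (n : ℤ) :
    fourierCoefAt (fun _ => 1) w n = if n = 0 then 1 else 0 := by
  rw [fourierCoefAt]
  split_ifs with hn
  · simp [hn]
  · have hc : 2 * Real.pi * Complex.I * (-n : ℤ) ≠ 0 := by
      refine mul_ne_zero Complex.two_pi_I_ne_zero ?_
      exact_mod_cast neg_ne_zero.2 hn
    have h : ∀ t : ℝ, (1 : ℂ) * ex (w + t) ^ (-n) =
        ex w ^ (-n) * Complex.exp (2 * Real.pi * Complex.I * (-n : ℤ) * t) := fun t => by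
      rw [one_mul, ex_add, mul_zpow, ex, ex, ← Complex.exp_int_mul (2 * Real.pi * Complex.I * t)]
      ring_nf
    simp only [h]
    rw [intervalIntegral.integral_const_mul, integral_exp_mul_complex hc]
    have : Complex.exp (2 * Real.pi * Complex.I * (-n : ℤ) * (1 : ℝ)) = 1 := by
      rw [Complex.ofReal_one, mul_one, mul_comm, Complex.exp_int_mul_two_pi_mul_I]
    rw [this]
    simp

/-- Termwise integration. As |x| is constant on a horizontal line, summability at t = 0 dominates
the series on the whole segment. -/
lemma hasSum_fourierCoefAt_mul {ι : Type*} [Countable ι] {F A : ℂ → ℂ} {w : ℂ}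
    (hF : Continuous fun t : ℝ => F (w + t)) {α : ι → ℂ} {e : ι → ℤ}
    (hA : ∀ t : ℝ, HasSum (fun i => α i * ex (w + t) ^ e i) (A (w + t))) (n : ℤ) :
    HasSum (fun i => α i * fourierCoefAt F w (n - e i))
      (fourierCoefAt (fun z => F z * A z) w n) := by
  have hterm : ∀ i, α i * fourierCoefAt F w (n - e i) =
      ∫ t in (0 : ℝ)..1, α i * (F (w + t) * ex (w + t) ^ (-(n - e i))) := fun i => by
    rw [intervalIntegral.integral_const_mul, fourierCoefAt]
  simp only [hterm]
  have h0 := (hA 0).summable.norm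
  simp only [Complex.ofReal_zero, add_zero] at h0
  refine intervalIntegral.hasSum_integral_of_dominated_convergence
    (fun i t => ‖α i * ex w ^ e i‖ * ‖F (w + t) * ex (w + t) ^ (-n)‖) (fun i => ?_) (fun i => ?_)
    ?_ ?_ ?_
  · exact ((continuous_fourierIntegrand hF _).const_mul _).aestronglyMeasurable
  · refine Eventually.of_forall fun t _ => ?_
    rw [neg_sub, sub_eq_add_neg, zpow_add₀ (ex_ne_zero _)]
    simp only [norm_mul, norm_zpow, norm_ex_add_ofReal]
    apply le_of_eq
    ring
  · exact Eventually.of_forall fun t _ => h0.mul_right _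
  · simp only [tsum_mul_right]
    exact ((continuous_fourierIntegrand hF _).norm.const_mul _).intervalIntegrable _ _
  · refine Eventually.of_forall fun t _ => ?_
    rw [mul_right_comm]
    refine ((hA t).mul_left (F (w + t) * ex (w + t) ^ (-n))).congr_fun fun i => ?_
    rw [neg_sub, sub_eq_add_neg, zpow_add₀ (ex_ne_zero _)]
    ring

lemma hasSum_fourierCoefAt {ι : Type*} [Countable ι] {A : ℂ → ℂ} {w : ℂ} {α : ι → ℂ} {e : ι → ℤ}
    (hA : ∀ t : ℝ, HasSum (fun i => α i * ex (w + t) ^ e i) (A (w + t))) (n : ℤ) :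
    HasSum (fun i => if e i = n then α i else 0) (fourierCoefAt A w n) := by
  have h := hasSum_fourierCoefAt_mul (F := fun _ => 1) continuous_const hA n
  simp only [one_mul] at h
  refine h.congr_fun fun i => ?_
  rw [fourierCoefAt_one]
  simp [sub_eq_zero, eq_comm]

lemma fourierCoefAt_of_injective {ι : Type*} [Countable ι] {A : ℂ → ℂ} {w : ℂ} {α : ι → ℂ}
    {e : ι → ℤ} (he : Function.Injective e)
    (hA : ∀ t : ℝ, HasSum (fun i => α i * ex (w + t) ^ e i) (A (w + t))) (i : ι) :
    fourierCoefAt A w (e i) = α i := by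
  refine (hasSum_fourierCoefAt hA (e i)).unique ?_
  have := hasSum_single (f := fun j => if e j = e i then α j else 0) i
    (fun j hj => if_neg fun h => hj (he h))
  simpa using this

lemma fourierCoefAt_of_notMem_range {ι : Type*} [Countable ι] {A : ℂ → ℂ} {w : ℂ} {α : ι → ℂ}
    {e : ι → ℤ} {n : ℤ} (hn : ∀ i, e i ≠ n)
    (hA : ∀ t : ℝ, HasSum (fun i => α i * ex (w + t) ^ e i) (A (w + t))) :
    fourierCoefAt A w n = 0 := by
  refine (hasSum_fourierCoefAt hA n).unique ?_
  simp only [hn, if_false]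
  exact hasSum_zero

end Fourier

/-! ### A quintuple-type Bailey transform -/

section Bailey

variable {q : ℂ}

lemma pow_mul_qProdFin_inv_succ (hq : ‖q‖ < 1) (b : ℕ) :
    (1 - q ^ (b + 1)) / qProdFin q q (b + 1) = 1 / qProdFin q q b := by
  have := qProdFin_self_ne_zero hq b
  have := one_sub_pow_succ_ne_zero hq b
  rw [qProdFin_succ, pow_succ']
  field_simp

/-- The coefficient of `u^m` in the constant term of `Φ(x) / ((u x; q) (u / x; q))`, for
the bilateral series `Φ` with coefficient sequence `Φ`. -/
noncomputable def rogersSum (q : ℂ) (Φ : ℤ → ℂ) (m : ℕ) : ℂ :=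
  ∑ p ∈ Finset.HasAntidiagonal.antidiagonal m, Φ (p.2 - p.1) / (qProdFin q q p.1 * qProdFin q q p.2)

/-- The factor 1 - q^b kills the term b = 0 and otherwise cancels the last factor of (q; q)_b;
lowering b by one then shifts the argument of Φ. -/
lemma rogersSum_succ_sub (hq : ‖q‖ < 1) (Φ : ℤ → ℂ) (m : ℕ) :
    ∑ p ∈ Finset.HasAntidiagonal.antidiagonal (m + 1),
        Φ (p.2 - p.1) * (1 - q ^ p.2) / (qProdFin q q p.1 * qProdFin q q p.2) =
      rogersSum q (fun n => Φ (n + 1)) m := by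
  rw [Finset.Nat.sum_antidiagonal_succ', rogersSum]
  simp only [pow_zero, sub_self, mul_zero, zero_div, zero_add]
  refine Finset.sum_congr rfl fun p _ => ?_
  have := pow_mul_qProdFin_inv_succ hq p.2
  rw [show ((p.2 + 1 : ℕ) : ℤ) - p.1 = p.2 - p.1 + 1 by push_cast; ring]
  calc _ = Φ (p.2 - p.1 + 1) / qProdFin q q p.1 *
        ((1 - q ^ (p.2 + 1)) / qProdFin q q (p.2 + 1)) := by
        rw [div_mul_div_comm]
    _ = _ := by rw [this, div_mul_div_comm, mul_one]

/-- Reflection gives Q(2) = Q(-1) and the shift gives Q(2) = -Q(-1). -/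
lemma quintuple_coef_neg_one {Q : ℤ → ℂ} (hsymm : ∀ n, Q (1 - n) = Q n)
    (hshift : ∀ n, Q (n + 3) = -(q ^ (n + 1) * Q n)) : Q (-1) = 0 := by
  have h1 := hsymm (-1)
  have h2 := hshift (-1)
  norm_num at h1 h2
  rw [h1] at h2
  linear_combination h2 / 2

/-- The summand is odd under exchanging a and b: reflection followed by the shift turns Q(b - a - 1)
into -q^(a-b) Q(a - b - 1). -/
lemma sum_antidiagonal_quintuple_eq_zero {Q : ℤ → ℂ} (hsymm : ∀ n, Q (1 - n) = Q n)
    (hshift : ∀ n, Q (n + 3) = -(q ^ (n + 1) * Q n))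
    (hq0 : q ≠ 0) (m : ℕ) :
    ∑ p ∈ Finset.HasAntidiagonal.antidiagonal m,
      Q (p.2 - p.1 - 1) * q ^ p.2 / (qProdFin q q p.1 * qProdFin q q p.2) = 0 := by
  have h : ∑ p ∈ Finset.HasAntidiagonal.antidiagonal m,
      Q (p.2 - p.1 - 1) * q ^ p.2 / (qProdFin q q p.1 * qProdFin q q p.2) =
      -∑ p ∈ Finset.HasAntidiagonal.antidiagonal m,
      Q (p.2 - p.1 - 1) * q ^ p.2 / (qProdFin q q p.1 * qProdFin q q p.2) := by
    conv_rhs => rw [← Finset.Nat.sum_antidiagonal_swap, ← Finset.sum_neg_distrib]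
    refine Finset.sum_congr rfl fun p _ => ?_
    simp only [Prod.fst_swap, Prod.snd_swap]
    have h1 : Q (p.2 - p.1 - 1) = -(q ^ ((p.1 : ℤ) - p.2) * Q (p.1 - p.2 - 1)) := by
      rw [← hsymm, show (1 - ((p.2 : ℤ) - p.1 - 1)) = (p.1 - p.2 - 1) + 3 by ring, hshift]
      congr 3
      ring
    have h2 : q ^ ((p.1 : ℤ) - p.2) * q ^ p.2 = q ^ p.1 := by
      rw [zpow_sub₀ hq0, zpow_natCast, zpow_natCast, div_mul_cancel₀ _ (pow_ne_zero _ hq0)]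
    rw [h1, mul_comm (qProdFin q q p.2), ← h2]
    ring
  linear_combination h / 2

lemma rogersSum_quintuple {Q : ℤ → ℂ} (hsymm : ∀ n, Q (1 - n) = Q n)
    (hshift : ∀ n, Q (n + 3) = -(q ^ (n + 1) * Q n))
    (hq : ‖q‖ < 1) (hq0 : q ≠ 0) (m : ℕ) :
    rogersSum q Q m = Q 0 / qProdFin q q m := by
  induction m with
  | zero => simp [rogersSum, qProdFin]
  | succ m ih =>
    have h1 := rogersSum_succ_sub hq Q m
    have h2 : rogersSum q (fun n => Q (n + 1)) m = rogersSum q Q m := by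
      rw [rogersSum, rogersSum, ← Finset.Nat.sum_antidiagonal_swap]
      refine Finset.sum_congr rfl fun p _ => ?_
      simp only [Prod.fst_swap, Prod.snd_swap]
      rw [← hsymm, mul_comm (qProdFin q q p.2)]
      congr 2
      ring
    have h3 : ∑ p ∈ Finset.HasAntidiagonal.antidiagonal (m + 1),
        Q (p.2 - p.1) * (q ^ p.2 * (1 - q ^ p.1)) / (qProdFin q q p.1 * qProdFin q q p.2) = 0 := by
      rw [Finset.Nat.sum_antidiagonal_succ]
      simp only [pow_zero, sub_self, mul_zero, zero_div, zero_add]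
      rw [← sum_antidiagonal_quintuple_eq_zero hsymm hshift hq0 m]
      refine Finset.sum_congr rfl fun p _ => ?_
      have := pow_mul_qProdFin_inv_succ hq p.1
      rw [show (p.2 : ℤ) - ((p.1 + 1 : ℕ) : ℤ) = p.2 - p.1 - 1 by push_cast; ring]
      calc _ = Q (p.2 - p.1 - 1) * q ^ p.2 / qProdFin q q p.2 *
            ((1 - q ^ (p.1 + 1)) / qProdFin q q (p.1 + 1)) := by
            rw [div_mul_div_comm]; ring
        _ = _ := by rw [this, div_mul_div_comm, mul_one, mul_comm (qProdFin q q p.2)]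
    -- For a + b = m + 1, write 1 - q^(a+b) = (1 - q^b) + q^b (1 - q^a). The first part gives the
    -- sum for m by `h1` and `h2`, the second vanishes by `h3`.
    have h4 : (1 - q ^ (m + 1)) * rogersSum q Q (m + 1) = Q 0 / qProdFin q q m := by
      rw [← ih, ← h2, ← h1, ← add_zero (Finset.sum _ _), ← h3, ← Finset.sum_add_distrib, rogersSum,
        Finset.mul_sum]
      refine Finset.sum_congr rfl fun p hp => ?_
      rw [← Finset.HasAntidiagonal.mem_antidiagonal.1 hp, pow_add]
      ring
    have h5 := one_sub_pow_succ_ne_zero hq m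
    rw [qProdFin_succ, ← div_div, ← h4, pow_succ', mul_div_cancel_left₀ _ h5]

/-- Split 1 = (1 - q^b) + q^b in each term: the second part is the odd sum that vanishes, the first
lowers m + 1 to m and undoes the shift. -/
lemma rogersSum_quintuple_sub_one {Q : ℤ → ℂ} (hsymm : ∀ n, Q (1 - n) = Q n)
    (hshift : ∀ n, Q (n + 3) = -(q ^ (n + 1) * Q n))
    (hq : ‖q‖ < 1) (hq0 : q ≠ 0) (m : ℕ) :
    rogersSum q (fun n => Q (n - 1)) (m + 1) = Q 0 / qProdFin q q m := by
  have h1 := rogersSum_succ_sub hq (fun n => Q (n - 1)) m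
  have h2 := sum_antidiagonal_quintuple_eq_zero hsymm hshift hq0 (m + 1)
  simp only [add_sub_cancel_right] at h1
  rw [← rogersSum_quintuple hsymm hshift hq hq0 m, ← add_zero (rogersSum q Q m), ← h2, ← h1,
    rogersSum, ← Finset.sum_add_distrib]
  refine Finset.sum_congr rfl fun p _ => ?_
  ring

lemma theta_coef_add_two_mul {κ : ℤ → ℂ} (hκ : ∀ n, κ (n + 2) = q ^ (n + 1) * κ n)
    (d b : ℕ) : κ (d + 2 * b) = κ d * q ^ (b ^ 2 + b * d) := by
  induction b with
  | zero => simp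
  | succ b ih =>
    rw [show (d : ℤ) + 2 * ((b + 1 : ℕ) : ℤ) = d + 2 * b + 2 by push_cast; ring, hκ, ih,
      show (d : ℤ) + 2 * b + 1 = ((d + 2 * b + 1 : ℕ) : ℤ) by push_cast; ring, zpow_natCast]
    ring

/-- The Bailey transform: one double series over pairs (a, b), summed in two ways. Grouping by a + b
gives the finite sums. Grouping by n = a - b, the theta recursion gives κ(a + b) = κ(n) q^(b² +
b|n|) with b now the minimum, and Cauchy's identity sums over b. -/
lemma hasSum_theta_coef_mul_rogersSum {κ : ℤ → ℂ} (hκ : ∀ n, κ (n + 2) = q ^ (n + 1) * κ n)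
    (hκn : ∀ n, κ (-n) = κ n) (hq : ‖q‖ < 1) {Φ : ℤ → ℂ} {S : ℂ}
    (h : HasSum (fun n => κ n * Φ (-n)) S) :
    HasSum (fun m : ℕ => κ m * rogersSum q Φ m) ((qProd q q)⁻¹ * S) := by
  set T : ℕ × ℕ → ℂ := fun p => κ (p.1 + p.2) * (Φ (p.2 - p.1) /
    (qProdFin q q p.1 * qProdFin q q p.2)) with hT
  have hterm : ∀ n : ℤ, ∀ b : ℕ, T (diffMinEquiv (n, b)) = κ n * Φ (-n) *
      (q ^ (b ^ 2 + b * n.natAbs) /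
        (qProdFin q q (b + n.toNat) * qProdFin q q (b + (-n).toNat))) := by
    intro n b
    have h1 : κ n = κ n.natAbs := by
      obtain ⟨d, rfl | rfl⟩ := n.eq_nat_or_neg
      · simp
      · simp [hκn]
    have h2 : ((b + n.toNat : ℕ) : ℤ) + (b + (-n).toNat : ℕ) = n.natAbs + 2 * b := by omega
    have h3 : ((b + (-n).toNat : ℕ) : ℤ) - (b + n.toNat : ℕ) = -n := by omega
    simp only [hT, diffMinEquiv, Equiv.coe_fn_mk]
    rw [h2, h3, theta_coef_add_two_mul hκ, h1]
    ring
  have hsum : Summable (T ∘ diffMinEquiv) := by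
    obtain ⟨C, hC⟩ := exists_norm_cauchyTerm_le hq
    have hs := h.summable.norm.mul_of_nonneg
      ((summable_geometric_of_lt_one (norm_nonneg q) hq).mul_right C)
      (fun _ => norm_nonneg _) (fun b => (norm_nonneg _).trans (hC 0 b))
    refine Summable.of_norm_bounded hs fun p => ?_
    obtain ⟨n, b⟩ := p
    rw [Function.comp, hterm, norm_mul]
    refine mul_le_mul_of_nonneg_left ?_ (norm_nonneg _)
    refine (le_of_eq ?_).trans (hC n.natAbs b)
    obtain ⟨d, rfl | rfl⟩ := n.eq_nat_or_neg
    · simp [mul_comm]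
    · simp
  have h1 : HasSum (fun n => κ n * Φ (-n) * (qProd q q)⁻¹) (∑' p, (T ∘ diffMinEquiv) p) := by
    refine hsum.hasSum.prod_fiberwise fun n => ?_
    exact ((hasSum_cauchyTerm hq n).mul_left (κ n * Φ (-n))).congr_fun fun b => hterm n b
  have h2 : ∑' p, (T ∘ diffMinEquiv) p = (qProd q q)⁻¹ * S := by
    rw [mul_comm]
    exact h1.unique (h.mul_right _)
  have h3 : HasSum T ((qProd q q)⁻¹ * S) := by
    rw [← diffMinEquiv.hasSum_iff, ← h2]
    exact hsum.hasSum
  have h4 := (Finset.HasAntidiagonal.sigmaAntidiagonalEquivProd (A := ℕ)).hasSum_iff.2 h3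
  refine (h4.sigma fun m => hasSum_fintype _).congr_fun fun m => ?_
  rw [rogersSum, Finset.mul_sum, ← Finset.sum_coe_sort]
  refine Finset.sum_congr rfl fun p _ => ?_
  have := Finset.HasAntidiagonal.mem_antidiagonal.1 p.2
  simp only [hT, Function.comp, Finset.HasAntidiagonal.sigmaAntidiagonalEquivProd_apply]
  rw [show (m : ℤ) = p.1.1 + p.1.2 by exact_mod_cast this.symm]

lemma hasSum_theta_coef_div {Q : ℤ → ℂ} (hsymm : ∀ n, Q (1 - n) = Q n)
    (hshift : ∀ n, Q (n + 3) = -(q ^ (n + 1) * Q n))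
    {κ : ℤ → ℂ} (hκ : ∀ n, κ (n + 2) = q ^ (n + 1) * κ n)
    (hκn : ∀ n, κ (-n) = κ n)
    (hq : ‖q‖ < 1) (hq0 : q ≠ 0) (hQ0 : Q 0 = (qProd q q)⁻¹) {S : ℂ}
    (h : HasSum (fun n => κ n * Q (-n)) S) :
    HasSum (fun m : ℕ => κ m / qProdFin q q m) S := by
  have h0 := qProd_self_ne_zero hq
  have h1 := (hasSum_theta_coef_mul_rogersSum hκ hκn hq h).mul_left (qProd q q)
  rw [mul_inv_cancel_left₀ h0] at h1
  refine h1.congr_fun fun m => ?_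
  rw [rogersSum_quintuple hsymm hshift hq hq0, hQ0]
  field_simp

lemma hasSum_theta_coef_succ_div {Q : ℤ → ℂ} (hsymm : ∀ n, Q (1 - n) = Q n)
    (hshift : ∀ n, Q (n + 3) = -(q ^ (n + 1) * Q n))
    {κ : ℤ → ℂ} (hκ : ∀ n, κ (n + 2) = q ^ (n + 1) * κ n)
    (hκn : ∀ n, κ (-n) = κ n)
    (hq : ‖q‖ < 1) (hq0 : q ≠ 0) (hQ0 : Q 0 = (qProd q q)⁻¹) {S : ℂ}
    (h : HasSum (fun n => κ n * Q (-n - 1)) S) :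
    HasSum (fun m : ℕ => κ (m + 1) / qProdFin q q m) S := by
  have h0 := qProd_self_ne_zero hq
  have h1 := (hasSum_theta_coef_mul_rogersSum hκ hκn hq (Φ := fun n => Q (n - 1)) h).mul_left
    (qProd q q)
  rw [mul_inv_cancel_left₀ h0, ← hasSum_nat_add_iff' 1] at h1
  -- The term m = 0 is a multiple of Q(-1) = 0, so the series starts at m = 1 and can be reindexed.
  have hz : rogersSum q (fun n => Q (n - 1)) 0 = 0 := by
    simp [rogersSum, quintuple_coef_neg_one hsymm hshift]
  simp only [Finset.range_one, Finset.sum_singleton, hz, mul_zero, sub_zero] at h1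
  refine h1.congr_fun fun m => ?_
  rw [rogersSum_quintuple_sub_one hsymm hshift hq hq0, hQ0]
  push_cast
  field_simp

end Bailey

/-! ### Entire periodic functions and their functional equations -/

section Entire

variable {q τ : ℂ}

lemma mem_HolPer_univ {F : ℂ → ℂ} (hF : Differentiable ℂ F) (hF1 : ∀ z, F (z + 1) = F z) :
    F ∈ HolPer Set.univ :=
  ⟨hF.differentiableOn, fun z _ => hF1 z, fun _ hz => (hz trivial).elim⟩

lemma fourierCoefAt_univ {F : ℂ → ℂ} (hF : F ∈ HolPer Set.univ) (w w' : ℂ) (n : ℤ) :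
    fourierCoefAt F w n = fourierCoefAt F w' n :=
  fourierCoefAt_eq_of_mem isStrip_univ hF trivial trivial n

lemma fourierCoefAt_of_translate (hτ : ex τ = q) {F : ℂ → ℂ} (hF : F ∈ HolPer Set.univ) {c : ℂ}
    {m : ℤ} (h : ∀ z, F z = c * ex z ^ m * F (z + τ)) (w : ℂ) (n : ℤ) :
    fourierCoefAt F w n = c * q ^ (n - m) * fourierCoefAt F w (n - m) := by
  have h1 : fourierCoefAt F w n = fourierCoefAt (fun z => c * (ex z ^ m * F (z + τ))) w n := by
    congr 1
    ext z
    rw [h z]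
    ring
  rw [h1, fourierCoefAt_const_mul, fourierCoefAt_ex_zpow_mul (fun z => F (z + τ)),
    fourierCoefAt_add_right, hτ, fourierCoefAt_univ hF (w + τ) w]
  ring

lemma fourierCoefAt_of_reflect {F : ℂ → ℂ} (hF : F ∈ HolPer Set.univ) {m : ℤ}
    (h : ∀ z, F z = ex z ^ m * F (-z)) (w : ℂ) (n : ℤ) :
    fourierCoefAt F w n = fourierCoefAt F w (m - n) := by
  have h1 : fourierCoefAt F w n = fourierCoefAt (fun z => ex z ^ m * F (-z)) w n := by
    congr 1
    ext z
    exact h z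
  rw [h1, fourierCoefAt_ex_zpow_mul (fun z => F (-z)), fourierCoefAt_comp_neg
    (fun z => hF.2.1 z trivial), fourierCoefAt_univ hF (-w) w, neg_sub]

end Entire

/-! ### The theta functions `[α x^d; k]` -/

section MonomialVec

variable {q τ α : ℂ} {d : ℕ}

/-- The triple product in base q^d at the point -α q^k x^d. -/
lemma hasSum_monomialVec_aux (hq : ‖q‖ < 1) (hq0 : q ≠ 0) (hα : α ≠ 0) (hd : d ≠ 0) (k : ℤ)
    (z : ℂ) :
    HasSum
      (fun n : ℤ => α ^ n * q ^ ((d : ℤ) * (n * (n - 1) / 2) + k * n) * ex z ^ ((d : ℤ) * n + k))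
      (ex z ^ k * (qProd (q ^ d) (q ^ d) * thetaProd (-(α * q ^ k * ex z ^ d)) (q ^ d))) := by
  have hy : -(α * q ^ k * ex z ^ d) ≠ 0 :=
    neg_ne_zero.2 (mul_ne_zero (mul_ne_zero hα (zpow_ne_zero _ hq0)) (pow_ne_zero _ (ex_ne_zero z)))
  refine ((hasSum_thetaProd (norm_pow_lt_one hq hd) (pow_ne_zero d hq0) hy).mul_left
    (ex z ^ k)).congr_fun fun n => ?_
  have hs : (-1 : ℂ) ^ n * (-1) ^ n = 1 := by
    rw [← mul_zpow]; norm_num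
  rw [neg_eq_neg_one_mul (α * q ^ k * ex z ^ d), mul_zpow, mul_zpow, mul_zpow, zpow_add₀ hq0,
    zpow_add₀ (ex_ne_zero z),
    zpow_mul q, zpow_mul q, zpow_mul (ex z), zpow_natCast, zpow_natCast]
  linear_combination -(α ^ n * (q ^ d) ^ (n * (n - 1) / 2) * (q ^ k) ^ n * (ex z ^ d) ^ n *
    ex z ^ k) * hs

lemma monomialVec_eq (hq : ‖q‖ < 1) (hq0 : q ≠ 0) (hα : α ≠ 0) (hd : d ≠ 0) (k : ℤ) (z : ℂ) :
    monomialVec q α d k z =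
      ex z ^ k * (qProd (q ^ d) (q ^ d) * thetaProd (-(α * q ^ k * ex z ^ d)) (q ^ d)) :=
  (hasSum_monomialVec_aux hq hq0 hα hd k z).tsum_eq

lemma hasSum_monomialVec (hq : ‖q‖ < 1) (hq0 : q ≠ 0) (hα : α ≠ 0) (hd : d ≠ 0) (k : ℤ) (z : ℂ) :
    HasSum
      (fun n : ℤ => α ^ n * q ^ ((d : ℤ) * (n * (n - 1) / 2) + k * n) * ex z ^ ((d : ℤ) * n + k))
      (monomialVec q α d k z) := by
  rw [monomialVec_eq hq hq0 hα hd]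
  exact hasSum_monomialVec_aux hq hq0 hα hd k z

lemma differentiable_thetaProd_comp (hq : ‖q‖ < 1) {f : ℂ → ℂ} (hf : Differentiable ℂ f)
    (hf0 : ∀ z, f z ≠ 0) : Differentiable ℂ fun z => thetaProd (f z) q := by
  unfold thetaProd
  exact ((differentiable_qProd hq).comp hf).mul
    ((differentiable_qProd hq).comp ((differentiable_const q).div hf hf0))

lemma monomialVec_mem_HolPer (hq : ‖q‖ < 1) (hq0 : q ≠ 0) (hα : α ≠ 0) (hd : d ≠ 0) (k : ℤ) :
    monomialVec q α d k ∈ HolPer Set.univ := by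
  refine mem_HolPer_univ ?_ fun z => ?_
  · have h : monomialVec q α d k = _ := funext fun z => monomialVec_eq hq hq0 hα hd k z
    rw [h]
    refine (differentiable_ex_zpow k).mul ((differentiable_const _).mul
      (differentiable_thetaProd_comp (norm_pow_lt_one hq hd)
        ((differentiable_ex.pow d).const_mul _).neg fun z => ?_))
    exact neg_ne_zero.2 (mul_ne_zero (mul_ne_zero hα (zpow_ne_zero _ hq0))
      (pow_ne_zero _ (ex_ne_zero z)))
  · simp only [monomialVec, ex_add_one]

lemma continuous_monomialVec (hq : ‖q‖ < 1) (hq0 : q ≠ 0) (hα : α ≠ 0) (hd : d ≠ 0) (k : ℤ)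
    (w : ℂ) :
    Continuous fun t : ℝ => monomialVec q α d k (w + t) :=
  continuous_add_ofReal isStrip_univ (monomialVec_mem_HolPer hq hq0 hα hd k).1.continuousOn trivial

lemma monomialVec_translate (hq : ‖q‖ < 1) (hq0 : q ≠ 0) (hα : α ≠ 0) (hd : d ≠ 0) (hτ : ex τ = q)
    (k : ℤ) (z : ℂ) :
    monomialVec q α d k z = α * ex z ^ d * monomialVec q α d k (z + τ) := by
  have hx := ex_ne_zero z
  have hqk := zpow_ne_zero k hq0
  have hy : -(α * q ^ k * ex z ^ d) ≠ 0 :=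
    neg_ne_zero.2 (mul_ne_zero (mul_ne_zero hα hqk) (pow_ne_zero _ hx))
  rw [monomialVec_eq hq hq0 hα hd, monomialVec_eq hq hq0 hα hd,
    thetaProd_q_mul (norm_pow_lt_one hq hd) (pow_ne_zero d hq0) hy, ex_add, hτ, mul_zpow,
    show q ^ d * -(α * q ^ k * ex z ^ d) = -(α * q ^ k * (ex z * q) ^ d) by ring]
  ring

lemma monomialVec_add_degree (hq0 : q ≠ 0) (hα : α ≠ 0) (d k : ℤ) (z : ℂ) :
    monomialVec q α d k z = α * q ^ k * monomialVec q α d (k + d) z := by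
  rw [monomialVec, monomialVec, ← (Equiv.addRight (1 : ℤ)).tsum_eq, ← tsum_mul_left]
  refine tsum_congr fun n => ?_
  have h : (n + 1) * (n + 1 - 1) / 2 = n * (n - 1) / 2 + n := by
    have h1 := Int.two_mul_mul_sub_one_ediv_two n
    have h2 := Int.two_mul_mul_sub_one_ediv_two (n + 1)
    refine mul_left_cancel₀ (two_ne_zero (α := ℤ)) ?_
    rw [h2, mul_add, h1]
    ring
  rw [Equiv.coe_addRight, h, zpow_add_one₀ hα,
    show d * (n * (n - 1) / 2 + n) + k * (n + 1) =
      (d * (n * (n - 1) / 2) + (k + d) * n) + k by ring,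
    zpow_add₀ hq0 _ k, show d * (n + 1) + k = d * n + (k + d) by ring]
  ring

/-- Substitute -n for n. The condition on α gives α^(-n) q^(2n) = α^n and covers both α = q and α =
-q. -/
lemma monomialVec_neg (hq0 : q ≠ 0) (hα : α ^ 2 = q ^ 2) (d k : ℤ) (z : ℂ) :
    monomialVec q α d (d - 2 - k) z = ex z ^ (d - 2) * monomialVec q α d k (-z) := by
  have hα0 : α ≠ 0 := fun h => by
    rw [h, zero_pow two_ne_zero] at hα
    exact pow_ne_zero 2 hq0 hα.symm
  rw [monomialVec, monomialVec, ← (Equiv.neg ℤ).tsum_eq, ← tsum_mul_left]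
  refine tsum_congr fun n => ?_
  have h : -n * (-n - 1) / 2 = n * (n - 1) / 2 + n := by
    have h1 := Int.two_mul_mul_sub_one_ediv_two n
    have h2 := Int.two_mul_mul_sub_one_ediv_two (-n)
    refine mul_left_cancel₀ (two_ne_zero (α := ℤ)) ?_
    rw [h2, mul_add, h1]
    ring
  have h3 : α ^ (-n) * q ^ (2 * n) = α ^ n := by
    rw [zpow_mul, show q ^ (2 : ℤ) = α ^ (2 : ℤ) by exact_mod_cast hα.symm, ← zpow_mul,
      ← zpow_add₀ hα0]
    congr 1
    ring
  rw [Equiv.neg_apply, h, ← h3, ex_neg, inv_zpow',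
    show d * (n * (n - 1) / 2 + n) + (d - 2 - k) * -n = (d * (n * (n - 1) / 2) + k * n) + 2 * n by
      ring, show d * -n + (d - 2 - k) = (d - 2) + -(d * n + k) by ring,
    zpow_add₀ hq0 _ (2 * n), zpow_add₀ (ex_ne_zero z)]
  ring

lemma fourierCoefAt_monomialVec (hq : ‖q‖ < 1) (hq0 : q ≠ 0) (hα : α ≠ 0) (hd : d ≠ 0) (k : ℤ)
    (w : ℂ) (n : ℤ) : fourierCoefAt (monomialVec q α d k) w (d * n + k) =
      α ^ n * q ^ ((d : ℤ) * (n * (n - 1) / 2) + k * n) :=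
  fourierCoefAt_of_injective (e := fun n : ℤ => (d : ℤ) * n + k)
    (fun a b h => by simpa [hd] using h)
    (fun t => hasSum_monomialVec hq hq0 hα hd k (w + t)) n

lemma fourierCoefAt_monomialVec_eq_zero (hq : ‖q‖ < 1) (hq0 : q ≠ 0) (hα : α ≠ 0) (hd : d ≠ 0)
    (k : ℤ) (w : ℂ) {n : ℤ} (hn : ¬ (d : ℤ) ∣ n - k) :
    fourierCoefAt (monomialVec q α d k) w n = 0 :=
  fourierCoefAt_of_notMem_range (e := fun n : ℤ => (d : ℤ) * n + k)
    (fun m h => hn ⟨m, by rw [← h]; ring⟩)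
    (fun t => hasSum_monomialVec hq hq0 hα hd k (w + t))

end MonomialVec

/-! ### The quintuple product -/

section Quintuple

variable {q τ : ℂ}

lemma thetaProd_mul_thetaProd_neg (hq : ‖q‖ < 1) (y : ℂ) :
    thetaProd y q * thetaProd (-y) q = thetaProd (y ^ 2) (q ^ 2) := by
  rw [thetaProd, thetaProd, thetaProd, ← div_pow, ← qProd_mul_qProd_neg hq y,
    ← qProd_mul_qProd_neg hq (q / y), div_neg]
  ring

lemma thetaProd_eq_even_mul_odd (hq : ‖q‖ < 1) (hq0 : q ≠ 0) (y : ℂ) :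
    thetaProd y q = thetaProd (q * y) (q ^ 2) * thetaProd y (q ^ 2) := by
  rw [thetaProd, thetaProd, thetaProd, qProd_eq_even_mul_odd hq y,
    qProd_eq_even_mul_odd hq (q / y), show q ^ 2 / (q * y) = q / y by field_simp,
    show q ^ 2 / y = q * (q / y) by ring]
  ring

/-- The function `⟨x²; q⟩ / ⟨x; q⟩ = ⟨-x; q⟩ ⟨q x²; q²⟩`. -/
noncomputable def quintProd (q z : ℂ) : ℂ :=
  thetaProd (-ex z) q * thetaProd (q * ex z ^ 2) (q ^ 2)

lemma quintProd_mul_thetaProd (hq : ‖q‖ < 1) (hq0 : q ≠ 0) (z : ℂ) :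
    quintProd q z * thetaProd (ex z) q = thetaProd (ex z ^ 2) q := by
  rw [thetaProd_eq_even_mul_odd hq hq0 (ex z ^ 2), ← thetaProd_mul_thetaProd_neg hq (ex z),
    quintProd]
  ring

lemma quintProd_mem_HolPer (hq : ‖q‖ < 1) (hq0 : q ≠ 0) : quintProd q ∈ HolPer Set.univ := by
  refine mem_HolPer_univ ?_ fun z => by simp only [quintProd, ex_add_one]
  exact (differentiable_thetaProd_comp hq differentiable_ex.neg
    fun z => neg_ne_zero.2 (ex_ne_zero z)).mul
    (differentiable_thetaProd_comp (norm_pow_lt_one hq two_ne_zero)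
      ((differentiable_ex.pow 2).const_mul q)
      fun z => mul_ne_zero hq0 (pow_ne_zero _ (ex_ne_zero z)))

lemma quintProd_translate (hq : ‖q‖ < 1) (hq0 : q ≠ 0) (hτ : ex τ = q) (z : ℂ) :
    quintProd q z = -q * ex z ^ (3 : ℤ) * quintProd q (z + τ) := by
  have hx := ex_ne_zero z
  rw [quintProd, quintProd, thetaProd_q_mul hq hq0 (neg_ne_zero.2 hx),
    thetaProd_q_mul (norm_pow_lt_one hq two_ne_zero) (pow_ne_zero 2 hq0)
      (mul_ne_zero hq0 (pow_ne_zero 2 hx)), ex_add, hτ,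
    show q * -ex z = -(ex z * q) by ring,
    show q ^ 2 * (q * ex z ^ 2) = q * (ex z * q) ^ 2 by ring]
  norm_cast
  ring

lemma quintProd_reflect (hq : ‖q‖ < 1) (hq0 : q ≠ 0) (z : ℂ) :
    quintProd q z = ex z ^ (1 : ℤ) * quintProd q (-z) := by
  have hx := ex_ne_zero z
  rw [quintProd, quintProd, ex_neg, ← inv_neg, thetaProd_inv hq hq0 (neg_ne_zero.2 hx),
    show q * (ex z)⁻¹ ^ 2 = q ^ 2 / (q * ex z ^ 2) by field_simp,
    thetaProd_q_div (pow_ne_zero 2 hq0), zpow_one]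
  field_simp

lemma fourierCoefAt_quintProd_add_three (hq : ‖q‖ < 1) (hq0 : q ≠ 0) (hτ : ex τ = q) (w : ℂ)
    (n : ℤ) : fourierCoefAt (quintProd q) w (n + 3) =
      -(q ^ (n + 1) * fourierCoefAt (quintProd q) w n) := by
  rw [fourierCoefAt_of_translate hτ (quintProd_mem_HolPer hq hq0)
    (quintProd_translate hq hq0 hτ), add_sub_cancel_right, zpow_add_one₀ hq0]
  ring

lemma fourierCoefAt_quintProd_one_sub (hq : ‖q‖ < 1) (hq0 : q ≠ 0) (w : ℂ)
    (n : ℤ) : fourierCoefAt (quintProd q) w (1 - n) = fourierCoefAt (quintProd q) w n :=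
  (fourierCoefAt_of_reflect (quintProd_mem_HolPer hq hq0) (quintProd_reflect hq hq0) w n).symm

/-- Both factors of `quintProd` are theta series, so the constant term of their product is a
convolution. It is again a triple product series, in base q⁶ at q², and sums to (q²; q²). -/
lemma fourierCoefAt_quintProd_zero (hq : ‖q‖ < 1) (hq0 : q ≠ 0) (w : ℂ) :
    fourierCoefAt (quintProd q) w 0 = (qProd q q)⁻¹ := by
  have h2 := norm_pow_lt_one hq two_ne_zero
  have hq2 := pow_ne_zero 2 hq0
  have hA : ∀ z, monomialVec q 1 1 0 z = qProd q q * thetaProd (-ex z) q := fun z => by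
    have := monomialVec_eq hq hq0 one_ne_zero (d := 1) one_ne_zero 0 z
    simpa using this
  have hF : ∀ z, monomialVec q (-q) 2 0 z =
      qProd (q ^ 2) (q ^ 2) * thetaProd (q * ex z ^ 2) (q ^ 2) := fun z => by
    have := monomialVec_eq hq hq0 (neg_ne_zero.2 hq0) (d := 2) two_ne_zero 0 z
    simpa using this
  have h1 := hasSum_fourierCoefAt_mul (e := fun n : ℤ => ((1 : ℕ) : ℤ) * n + 0)
    (continuous_monomialVec hq hq0 (neg_ne_zero.2 hq0) two_ne_zero 0 w)
    (fun t => hasSum_monomialVec hq hq0 one_ne_zero one_ne_zero 0 (w + t)) 0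
  have hinj : Function.Injective fun m : ℤ => 2 * m := fun a b h => by simpa using h
  -- Only even powers of x occur in [-q x²; 0], so only even n contribute.
  rw [← hinj.hasSum_iff] at h1
  swap
  · intro n hn
    rw [fourierCoefAt_monomialVec_eq_zero hq hq0 (neg_ne_zero.2 hq0) two_ne_zero, mul_zero]
    rintro ⟨m, hm⟩
    exact hn ⟨-m, by push_cast at hm; simp only; linarith⟩
  have h3 := hasSum_thetaProd (norm_pow_lt_one hq (k := 6) (by norm_num)) (pow_ne_zero 6 hq0) hq2
  -- Exponents of q² sorted modulo 3: (q²; q²) = (q²; q⁶)(q⁴; q⁶)(q⁶; q⁶).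
  have h4 : qProd (q ^ 6) (q ^ 6) * thetaProd (q ^ 2) (q ^ 6) = qProd (q ^ 2) (q ^ 2) := by
    rw [qProd_eq_mul_mod_three h2, thetaProd, show q ^ 6 / q ^ 2 = q ^ 4 by field_simp]
    ring_nf
  rw [h4] at h3
  have h5 := h1.unique (h3.congr_fun fun m => ?_)
  · have h6 : (fun z => monomialVec q (-q) (2 : ℕ) 0 z * monomialVec q 1 (1 : ℕ) 0 z) =
        fun z => (qProd q q * qProd (q ^ 2) (q ^ 2)) * quintProd q z := by
      ext z
      push_cast
      rw [hA, hF, quintProd]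
      ring
    rw [h6, fourierCoefAt_const_mul] at h5
    have h7 := qProd_self_ne_zero h2
    have h8 := qProd_self_ne_zero hq
    field_simp
    refine mul_left_cancel₀ h7 ?_
    linear_combination h5
  · have h9 := fourierCoefAt_monomialVec hq hq0 (neg_ne_zero.2 hq0) two_ne_zero 0 w (-m)
    simp only [Function.comp]
    rw [show (0 : ℤ) - (((1 : ℕ) : ℤ) * (2 * m) + 0) = ((2 : ℕ) : ℤ) * (-m) + 0 by
      push_cast; ring, h9]
    have ha : 2 * m * (2 * m - 1) / 2 = m * (2 * m - 1) := by
      rw [mul_assoc, Int.mul_ediv_cancel_left _ two_ne_zero]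
    have hb := Int.two_mul_mul_sub_one_ediv_two (-m)
    have hc := Int.two_mul_mul_sub_one_ediv_two m
    have hs : (-q) ^ (-m) = (-1) ^ m * q ^ (-m) := by
      rw [neg_eq_neg_one_mul, mul_zpow, zpow_neg (-1 : ℂ), ← inv_zpow]
      norm_num
    rw [hs, ← zpow_natCast q 6, ← zpow_natCast q 2, ← zpow_mul, ← zpow_mul, one_zpow, ha]
    push_cast
    rw [hb, one_mul, mul_assoc, mul_assoc, mul_left_comm, ← zpow_add₀ hq0, one_mul, zero_mul,
      add_zero, ← zpow_add₀ hq0, ← zpow_add₀ hq0]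
    congr 2
    linear_combination -3 * hc

end Quintuple

/-! ### The coordinate maps given by Fourier coefficients -/

section Coordinates

/-- The linear map that sends a periodic function to two of its Fourier coefficients. -/
noncomputable def fourierCoefPair {D : Set ℂ} (hD : IsStrip D) {S : Submodule ℂ (ℂ → ℂ)}
    (hS : S ≤ HolPer D) {w : ℂ} (hw : w ∈ D) (e : Fin 2 → ℤ) : S →ₗ[ℂ] Fin 2 → ℂ where
  toFun F i := fourierCoefAt F w (e i)
  map_add' F G := funext fun _ => fourierCoefAt_add
    (continuous_add_ofReal hD (hS F.2).1.continuousOn hw)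
    (continuous_add_ofReal hD (hS G.2).1.continuousOn hw) _
  map_smul' c _ := funext fun _ => fourierCoefAt_const_mul _ c w _

@[simp]
lemma fourierCoefPair_apply {D : Set ℂ} (hD : IsStrip D) {S : Submodule ℂ (ℂ → ℂ)}
    (hS : S ≤ HolPer D) {w : ℂ} (hw : w ∈ D) (e : Fin 2 → ℤ) (F : S) (i : Fin 2) :
    fourierCoefPair hD hS hw e F i = fourierCoefAt F w (e i) := rfl

lemma eq_zero_of_fourierCoefAt {D : Set ℂ} (hD : IsStrip D) {F : ℂ → ℂ} (hF : F ∈ HolPer D) {w : ℂ}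
    (hw : w ∈ D) (h : ∀ n, fourierCoefAt F w n = 0) : F = 0 := by
  ext z
  by_cases hz : z ∈ D
  · refine eq_zero_of_fourierCoefAt_eq_zero (continuous_add_ofReal hD hF.1.continuousOn hz)
      (fun t => hF.2.1 _ (hD.add_ofReal hz t)) fun n => ?_
    rw [fourierCoefAt_eq_of_mem hD hF hz hw, h]
  · exact hF.2.2 z hz

end Coordinates

/-! ### The space `T_ℂ(-q x⁵) ∩ S_ℂ(x³)` -/

section SeptSpace

variable {q τ : ℂ}

lemma mem_septSpace_iff {F : ℂ → ℂ} : F ∈ septSpace q τ ↔ F ∈ HolPer Set.univ ∧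
    (∀ z, F z = -q * ex z ^ 5 * F (z + τ)) ∧ ∀ z, F z = ex z ^ 3 * F (-z) :=
  ⟨fun h => ⟨h.1.1, fun z => h.1.2 z trivial trivial, fun z => h.2.2 z trivial trivial⟩,
    fun h => ⟨⟨h.1, fun z _ _ => h.2.1 z⟩, ⟨h.1, fun z _ _ => h.2.2 z⟩⟩⟩

lemma septSpace_le_HolPer : septSpace q τ ≤ HolPer Set.univ := fun _ h => h.1.1

/-- Translation ties coefficients with indices congruent modulo 5, and reflection exchanges residues
0 with 3 and 1 with 2. Residue 4 is fixed, but the two relations between indices 4 and -1 have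
opposite signs, so it carries nothing. -/
lemma eq_zero_of_mem_septSpace (hq0 : q ≠ 0) (hτ : ex τ = q) {F : ℂ → ℂ} (hF : F ∈ septSpace q τ)
    {w : ℂ} (h0 : fourierCoefAt F w 0 = 0) (h1 : fourierCoefAt F w 1 = 0) : F = 0 := by
  obtain ⟨hH, hT, hS⟩ := mem_septSpace_iff.1 hF
  have ht : ∀ n, fourierCoefAt F w n = -q * q ^ (n - 5) * fourierCoefAt F w (n - 5) :=
    fourierCoefAt_of_translate hτ hH (fun z => by exact_mod_cast hT z) w
  have hs : ∀ n, fourierCoefAt F w n = fourierCoefAt F w (3 - n) :=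
    fourierCoefAt_of_reflect hH (fun z => by exact_mod_cast hS z) w
  have hstep : ∀ n, fourierCoefAt F w (n + 5) = 0 ↔ fourierCoefAt F w n = 0 := fun n => by
    rw [ht, add_sub_cancel_right]
    simp [hq0, zpow_ne_zero n hq0]
  have h2 : fourierCoefAt F w 2 = 0 := by rw [hs]; exact h1
  have h3 : fourierCoefAt F w 3 = 0 := by rw [hs]; exact h0
  have h4 : fourierCoefAt F w 4 = 0 := by
    have ha := ht 4
    have hb := hs 4
    norm_num at ha hb
    rw [← hb, mul_inv_cancel₀ hq0] at ha
    linear_combination ha / 2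
  have hk : ∀ r, fourierCoefAt F w r = 0 → ∀ k : ℤ, fourierCoefAt F w (r + 5 * k) = 0 := by
    intro r hr k
    induction k using Int.induction_on with
    | zero => simpa using hr
    | succ k ih => rwa [mul_add, mul_one, ← add_assoc, hstep]
    | pred k ih =>
      rw [← hstep]
      convert ih using 2
      ring
  refine eq_zero_of_fourierCoefAt isStrip_univ hH (Set.mem_univ w) fun n => ?_
  rw [← Int.emod_add_mul_ediv n 5]
  refine hk _ ?_ _
  have hlo := Int.emod_nonneg n (show (5 : ℤ) ≠ 0 by norm_num)
  have hhi := Int.emod_lt_of_pos n (show (0 : ℤ) < 5 by norm_num)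
  interval_cases n % 5 <;> assumption

lemma monomialVec_five_mem_HolPer (hq : ‖q‖ < 1) (hq0 : q ≠ 0) (k : ℤ) :
    monomialVec q (-q) 5 k ∈ HolPer Set.univ :=
  monomialVec_mem_HolPer (d := 5) hq hq0 (neg_ne_zero.2 hq0) (by norm_num) k

lemma monomialVec_five_add_mem_septSpace (hq : ‖q‖ < 1) (hq0 : q ≠ 0) (hτ : ex τ = q) (k : ℤ) :
    (fun z => monomialVec q (-q) 5 k z + monomialVec q (-q) 5 (3 - k) z) ∈ septSpace q τ := by
  have ht : ∀ k z, monomialVec q (-q) 5 k z = -q * ex z ^ 5 * monomialVec q (-q) 5 k (z + τ) :=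
    fun k z => monomialVec_translate (d := 5) hq hq0 (neg_ne_zero.2 hq0) (by norm_num) hτ k z
  have hs : ∀ k z, monomialVec q (-q) 5 (3 - k) z = ex z ^ 3 * monomialVec q (-q) 5 k (-z) := by
    intro k z
    have := monomialVec_neg hq0 (neg_sq q) 5 k z
    norm_num at this
    exact_mod_cast this
  refine mem_septSpace_iff.2 ⟨(HolPer Set.univ).add_mem (monomialVec_five_mem_HolPer hq hq0 k)
    (monomialVec_five_mem_HolPer hq hq0 (3 - k)), fun z => ?_, fun z => ?_⟩
  · rw [ht k, ht (3 - k)]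
    ring
  · have h1 := hs (3 - k) z
    rw [sub_sub_cancel] at h1
    rw [hs k, h1]
    ring

lemma septVec₀_mem (hq : ‖q‖ < 1) (hq0 : q ≠ 0) (hτ : ex τ = q) : septVec₀ q ∈ septSpace q τ :=
  monomialVec_five_add_mem_septSpace hq hq0 hτ 1

lemma septVec₁_mem (hq : ‖q‖ < 1) (hq0 : q ≠ 0) (hτ : ex τ = q) : septVec₁ q ∈ septSpace q τ := by
  have := monomialVec_five_add_mem_septSpace hq hq0 hτ 0
  rw [sub_zero] at this
  exact this

lemma fourierCoefAt_monomialVec_five_self (hq : ‖q‖ < 1) (hq0 : q ≠ 0) (w : ℂ) (k : ℤ) :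
    fourierCoefAt (monomialVec q (-q) 5 k) w k = 1 := by
  have := fourierCoefAt_monomialVec (d := 5) hq hq0 (neg_ne_zero.2 hq0) (by norm_num) k w 0
  simpa using this

lemma fourierCoefAt_monomialVec_five_eq_zero (hq : ‖q‖ < 1) (hq0 : q ≠ 0) (w : ℂ) {k n : ℤ}
    (h : ¬ (5 : ℤ) ∣ n - k) : fourierCoefAt (monomialVec q (-q) 5 k) w n = 0 :=
  fourierCoefAt_monomialVec_eq_zero (d := 5) hq hq0 (neg_ne_zero.2 hq0) (by norm_num) k w h

lemma fourierCoefAt_monomialVec_five_add (hq : ‖q‖ < 1) (hq0 : q ≠ 0) (w : ℂ) (k l n : ℤ) :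
    fourierCoefAt (fun z => monomialVec q (-q) 5 k z + monomialVec q (-q) 5 l z) w n =
      fourierCoefAt (monomialVec q (-q) 5 k) w n + fourierCoefAt (monomialVec q (-q) 5 l) w n :=
  fourierCoefAt_add
    (continuous_monomialVec (d := 5) hq hq0 (neg_ne_zero.2 hq0) (by norm_num) k w)
    (continuous_monomialVec (d := 5) hq hq0 (neg_ne_zero.2 hq0) (by norm_num) l w) n

lemma fourierCoefAt_septVec₀ (hq : ‖q‖ < 1) (hq0 : q ≠ 0) (w : ℂ) :
    fourierCoefAt (septVec₀ q) w 0 = 0 ∧ fourierCoefAt (septVec₀ q) w 1 = 1 := by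
  have h := fourierCoefAt_monomialVec_five_add hq hq0 w 1 2
  refine ⟨(h 0).trans ?_, (h 1).trans ?_⟩
  · rw [fourierCoefAt_monomialVec_five_eq_zero hq hq0 w (by norm_num),
      fourierCoefAt_monomialVec_five_eq_zero hq hq0 w (by norm_num), add_zero]
  · rw [fourierCoefAt_monomialVec_five_self hq hq0,
      fourierCoefAt_monomialVec_five_eq_zero hq hq0 w (by norm_num), add_zero]

lemma fourierCoefAt_septVec₁ (hq : ‖q‖ < 1) (hq0 : q ≠ 0) (w : ℂ) :
    fourierCoefAt (septVec₁ q) w 0 = 1 ∧ fourierCoefAt (septVec₁ q) w 1 = 0 := by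
  have h := fourierCoefAt_monomialVec_five_add hq hq0 w 0 3
  refine ⟨(h 0).trans ?_, (h 1).trans ?_⟩
  · rw [fourierCoefAt_monomialVec_five_self hq hq0,
      fourierCoefAt_monomialVec_five_eq_zero hq hq0 w (by norm_num), add_zero]
  · rw [fourierCoefAt_monomialVec_five_eq_zero hq hq0 w (by norm_num),
      fourierCoefAt_monomialVec_five_eq_zero hq hq0 w (by norm_num), add_zero]

/-- The coordinates of `T_ℂ(-q x⁵) ∩ S_ℂ(x³)`: the Fourier coefficients at `x` and at `1`. -/
noncomputable def septCoord (q τ : ℂ) : septSpace q τ →ₗ[ℂ] Fin 2 → ℂ :=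
  fourierCoefPair isStrip_univ septSpace_le_HolPer (Set.mem_univ (-Complex.I)) ![1, 0]

lemma septCoord_injective (hq0 : q ≠ 0) (hτ : ex τ = q) : Function.Injective (septCoord q τ) := by
  refine (injective_iff_map_eq_zero _).2 fun F hF => Subtype.ext ?_
  exact eq_zero_of_mem_septSpace hq0 hτ F.2 (congrFun hF 1) (congrFun hF 0)

lemma septCoord_septVec₀ (hq : ‖q‖ < 1) (hq0 : q ≠ 0) (hτ : ex τ = q) :
    septCoord q τ ⟨septVec₀ q, septVec₀_mem hq hq0 hτ⟩ = Pi.single 0 1 := by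
  ext i
  fin_cases i
  · simpa [septCoord] using (fourierCoefAt_septVec₀ hq hq0 _).2
  · simpa [septCoord] using (fourierCoefAt_septVec₀ hq hq0 _).1

lemma septCoord_septVec₁ (hq : ‖q‖ < 1) (hq0 : q ≠ 0) (hτ : ex τ = q) :
    septCoord q τ ⟨septVec₁ q, septVec₁_mem hq hq0 hτ⟩ = Pi.single 1 1 := by
  ext i
  fin_cases i
  · simpa [septCoord] using (fourierCoefAt_septVec₁ hq hq0 _).2
  · simpa [septCoord] using (fourierCoefAt_septVec₁ hq hq0 _).1

lemma eq_add_of_mem_septSpace (hq : ‖q‖ < 1) (hq0 : q ≠ 0) (hτ : ex τ = q) {F : ℂ → ℂ}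
    (hF : F ∈ septSpace q τ) (z : ℂ) :
    F z = fourierCoefAt F (-Complex.I) 1 * septVec₀ q z +
      fourierCoefAt F (-Complex.I) 0 * septVec₁ q z := by
  have h : (⟨F, hF⟩ : septSpace q τ) = fourierCoefAt F (-Complex.I) 1 •
      ⟨septVec₀ q, septVec₀_mem hq hq0 hτ⟩ + fourierCoefAt F (-Complex.I) 0 •
      ⟨septVec₁ q, septVec₁_mem hq hq0 hτ⟩ := by
    refine septCoord_injective hq0 hτ ?_
    rw [map_add, map_smul, map_smul, septCoord_septVec₀ hq hq0 hτ, septCoord_septVec₁ hq hq0 hτ]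
    ext i
    fin_cases i <;> simp [septCoord]
  have h2 := congrArg (fun G : septSpace q τ => (G : ℂ → ℂ) z) h
  simpa using h2

lemma exists_basis_septSpace (hq : ‖q‖ < 1) (hq0 : q ≠ 0) (hτ : ex τ = q) :
    ∃ b : Module.Basis (Fin 2) ℂ (septSpace q τ),
      (b 0 : ℂ → ℂ) = septVec₀ q ∧ (b 1 : ℂ → ℂ) = septVec₁ q := by
  have hsurj : Function.Surjective (septCoord q τ) := fun v => by
    refine ⟨v 0 • ⟨septVec₀ q, septVec₀_mem hq hq0 hτ⟩ +
      v 1 • ⟨septVec₁ q, septVec₁_mem hq hq0 hτ⟩, ?_⟩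
    rw [map_add, map_smul, map_smul, septCoord_septVec₀ hq hq0 hτ, septCoord_septVec₁ hq hq0 hτ]
    ext i
    fin_cases i <;> simp
  set E := LinearEquiv.ofBijective (septCoord q τ) ⟨septCoord_injective hq0 hτ, hsurj⟩ with hE
  refine ⟨Module.Basis.ofEquivFun E, ?_, ?_⟩
  · rw [Module.Basis.coe_ofEquivFun]
    exact congrArg Subtype.val ((LinearEquiv.symm_apply_eq E).2 (septCoord_septVec₀ hq hq0 hτ).symm)
  · rw [Module.Basis.coe_ofEquivFun]
    exact congrArg Subtype.val ((LinearEquiv.symm_apply_eq E).2 (septCoord_septVec₁ hq hq0 hτ).symm)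

end SeptSpace

/-! ### The space `T_{H⁻}(q x² - x)` -/

section RRSpace

variable {q τ : ℂ}

lemma isOpen_lowerHalf : IsOpen lowerHalf := isOpen_lt Complex.continuous_im continuous_const

lemma neg_I_mem_lowerHalf : -Complex.I ∈ lowerHalf := by simp [lowerHalf]

lemma norm_inv_ex_lt_one {z : ℂ} (hz : z ∈ lowerHalf) : ‖(ex z)⁻¹‖ < 1 := by
  rw [norm_inv]
  exact inv_lt_one_of_one_lt₀ (one_lt_norm_ex hz)

lemma TSpace_le_HolPer (τ : ℂ) (D : Set ℂ) (f : ℂ → ℂ) : TSpace τ D f ≤ HolPer D := fun _ h => h.1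

lemma fourierCoefAt_of_mem_TSpace_rrFactor (hq0 : q ≠ 0) (hτ : ex τ = q) {F : ℂ → ℂ}
    (hF : F ∈ TSpace τ lowerHalf (rrFactor q)) {w : ℂ} (hw : w ∈ lowerHalf) (n : ℤ) :
    fourierCoefAt F w (n + 2) =
      q ^ (n + 1) * (fourierCoefAt F w n - fourierCoefAt F w (n + 1)) := by
  -- A point so low that u and u + τ both lie in H⁻, whatever the sign of Im τ; the coefficients do
  -- not depend on the line.
  set u : ℂ := w - τ.im * Complex.I - (|τ.im| : ℝ) * Complex.I with hu
  have him : u.im = w.im - τ.im - |τ.im| := by simp [hu]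
  have h1 := neg_abs_le τ.im
  have h2 := le_abs_self τ.im
  have hwim : w.im < 0 := hw
  have hu1 : u ∈ lowerHalf := by simp only [lowerHalf, Set.mem_ofPred_eq, him]; linarith
  have hu2 : u + τ ∈ lowerHalf := by
    simp only [lowerHalf, Set.mem_ofPred_eq, Complex.add_im, him]; linarith [abs_nonneg τ.im]
  have hc := fourierCoefAt_eq_of_mem isStrip_lowerHalf hF.1 hw hu1
  have hc2 := fourierCoefAt_eq_of_mem isStrip_lowerHalf hF.1 hu2 hu1
  have hcont : Continuous fun t : ℝ => F (u + t + τ) := by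
    have := continuous_add_ofReal isStrip_lowerHalf hF.1.1.continuousOn hu2
    simpa only [add_right_comm] using this
  have hexp : ∀ m : ℤ, Continuous fun t : ℝ => ex (u + t) ^ m * F (u + t + τ) := fun m =>
    ((continuous_ex_zpow m).comp (by fun_prop : Continuous fun t : ℝ => u + (t : ℂ))).mul hcont
  have h3 : fourierCoefAt F u (n + 2) = fourierCoefAt
      (fun z => q * (ex z ^ (2 : ℤ) * F (z + τ)) + (-1) * (ex z ^ (1 : ℤ) * F (z + τ)))
        u (n + 2) := by
    rw [fourierCoefAt, fourierCoefAt]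
    refine intervalIntegral.integral_congr fun t _ => ?_
    have h4 := hF.2 (u + t) (isStrip_lowerHalf.add_ofReal hu1 t) (by
      rw [add_right_comm]; exact isStrip_lowerHalf.add_ofReal hu2 t)
    rw [h4, rrFactor, zpow_one, zpow_ofNat]
    ring
  rw [hc, hc, hc, h3, fourierCoefAt_add ((hexp 2).const_mul q) ((hexp 1).const_mul (-1)),
    fourierCoefAt_const_mul, fourierCoefAt_const_mul,
    fourierCoefAt_ex_zpow_mul (fun z => F (z + τ)), fourierCoefAt_ex_zpow_mul (fun z => F (z + τ)),
    fourierCoefAt_add_right, fourierCoefAt_add_right, hτ, hc2, hc2, add_sub_cancel_right,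
    show n + 2 - 1 = n + 1 by ring, zpow_add_one₀ hq0]
  ring

/-- The order-two recursion runs in both directions because powers of q are invertible. -/
lemma eq_zero_of_mem_TSpace_rrFactor (hq0 : q ≠ 0) (hτ : ex τ = q) {F : ℂ → ℂ}
    (hF : F ∈ TSpace τ lowerHalf (rrFactor q)) {w : ℂ} (hw : w ∈ lowerHalf)
    (h0 : fourierCoefAt F w 0 = 0) (h1 : fourierCoefAt F w 1 = 0) : F = 0 := by
  have hrec := fourierCoefAt_of_mem_TSpace_rrFactor hq0 hτ hF hw
  have hall : ∀ n : ℤ, fourierCoefAt F w n = 0 ∧ fourierCoefAt F w (n + 1) = 0 := by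
    intro n
    induction n using Int.induction_on with
    | zero => exact ⟨h0, by simpa using h1⟩
    | succ n ih =>
      refine ⟨ih.2, ?_⟩
      rw [add_assoc, one_add_one_eq_two, hrec, ih.1, ih.2, sub_self, mul_zero]
    | pred n ih =>
      have h2 := hrec (-n - 1)
      rw [show -(n : ℤ) - 1 + 2 = -n + 1 by ring, sub_add_cancel, ih.1, ih.2, sub_zero] at h2
      refine ⟨(mul_eq_zero.1 h2.symm).resolve_left (zpow_ne_zero _ hq0), ?_⟩
      rw [sub_add_cancel]
      exact ih.1
  exact eq_zero_of_fourierCoefAt isStrip_lowerHalf hF.1 hw fun n => (hall n).1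

/-- The function `[q x²; k] / (1 / x; q)` on `H⁻`. -/
noncomputable def rrVec (q : ℂ) (k : ℤ) : ℂ → ℂ :=
  lowerHalf.indicator fun z => monomialVec q q 2 k z * (qProd (ex z)⁻¹ q)⁻¹

lemma rrVec_apply {z : ℂ} (hz : z ∈ lowerHalf) (k : ℤ) :
    rrVec q k z = monomialVec q q 2 k z * (qProd (ex z)⁻¹ q)⁻¹ := Set.indicator_of_mem hz _

lemma monomialVec_two_mem_HolPer (hq : ‖q‖ < 1) (hq0 : q ≠ 0) (k : ℤ) :
    monomialVec q q 2 k ∈ HolPer Set.univ :=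
  monomialVec_mem_HolPer (d := 2) hq hq0 hq0 two_ne_zero k

/-- [q x²; k] contributes the factor q x², and the denominator contributes 1 - 1/(q x), since (1/(q
x); q) = (1 - 1/(q x)) (1/x; q). The denominator has no zero on H⁻ because |1/x| < 1 there. -/
lemma rrVec_mem (hq : ‖q‖ < 1) (hq0 : q ≠ 0) (hτ : ex τ = q) (k : ℤ) :
    rrVec q k ∈ TSpace τ lowerHalf (rrFactor q) := by
  have hne : ∀ z ∈ lowerHalf, qProd (ex z)⁻¹ q ≠ 0 := fun z hz =>
    qProd_ne_zero_of_norm_lt_one hq (norm_inv_ex_lt_one hz)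
  have hK := monomialVec_two_mem_HolPer hq hq0 k
  refine ⟨⟨?_, fun z hz => ?_, fun z hz => Set.indicator_of_notMem hz _⟩, fun z hz hz' => ?_⟩
  · have hd : DifferentiableOn ℂ
        (fun z => monomialVec q q 2 k z * (qProd (ex z)⁻¹ q)⁻¹) lowerHalf := by
      refine (hK.1.mono (Set.subset_univ _)).mul (DifferentiableOn.inv ?_ hne)
      exact ((differentiable_qProd hq).comp
        (differentiable_ex.inv ex_ne_zero)).differentiableOn
    exact hd.congr fun z hz => rrVec_apply hz k
  · have hz1 : z + 1 ∈ lowerHalf := by simpa [lowerHalf] using hz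
    rw [rrVec_apply hz, rrVec_apply hz1, hK.2.1 z trivial, ex_add_one]
  · have hm := monomialVec_translate (d := 2) hq hq0 hq0 two_ne_zero hτ k z
    norm_num at hm
    have hx := ex_ne_zero z
    have h1 : qProd (ex (z + τ))⁻¹ q = (1 - (ex (z + τ))⁻¹) * qProd (ex z)⁻¹ q := by
      rw [qProd_eq_mul hq, ex_add, hτ, mul_inv, mul_left_comm, mul_inv_cancel₀ hq0, mul_one]
    have h2 : 1 - (ex (z + τ))⁻¹ ≠ 0 := fun h => by
      have := norm_inv_ex_lt_one hz'
      rw [← sub_eq_zero.1 h, norm_one] at this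
      exact lt_irrefl _ this
    have h3 := hne z hz
    rw [rrVec_apply hz, rrVec_apply hz', hm, h1, mul_inv, rrFactor]
    have h4 : q * ex z ^ 2 - ex z = q * ex z ^ 2 * (1 - (ex (z + τ))⁻¹) := by
      rw [ex_add, hτ]
      field_simp
    rw [h4]
    generalize 1 - (ex (z + τ))⁻¹ = u at h2
    field_simp

/-! The Fourier coefficients of `[q x²; k]`. -/

lemma fourierCoefAt_monomialVec_two_add_two (hq : ‖q‖ < 1) (hq0 : q ≠ 0) (hτ : ex τ = q) (k : ℤ)
    (w : ℂ) (n : ℤ) : fourierCoefAt (monomialVec q q 2 k) w (n + 2) =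
      q ^ (n + 1) * fourierCoefAt (monomialVec q q 2 k) w n := by
  have hm := monomialVec_translate (d := 2) hq hq0 hq0 two_ne_zero hτ k
  rw [fourierCoefAt_of_translate hτ (m := 2) (c := q) (monomialVec_two_mem_HolPer hq hq0 k)
    (fun z => by exact_mod_cast hm z), add_sub_cancel_right, zpow_add_one₀ hq0]
  ring

/-- Reflection sends k to -k. For k = 1, the index -1 returns to 1 with factor q · q⁻¹ = 1. -/
lemma monomialVec_two_neg (hq0 : q ≠ 0) {k : ℤ} (hk : k = 0 ∨ k = 1) (z : ℂ) :
    monomialVec q q 2 k z = ex z ^ (0 : ℤ) * monomialVec q q 2 k (-z) := by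
  have h := monomialVec_neg hq0 rfl 2 k z
  rw [sub_self, zero_sub] at h
  rw [← h]
  rcases hk with rfl | rfl
  · rfl
  · rw [monomialVec_add_degree hq0 hq0 2 (-1), zpow_neg_one, mul_inv_cancel₀ hq0, one_mul]
    rfl

lemma fourierCoefAt_monomialVec_two_neg (hq : ‖q‖ < 1) (hq0 : q ≠ 0) {k : ℤ} (hk : k = 0 ∨ k = 1)
    (w : ℂ) (n : ℤ) : fourierCoefAt (monomialVec q q 2 k) w (-n) =
      fourierCoefAt (monomialVec q q 2 k) w n := by
  rw [fourierCoefAt_of_reflect (monomialVec_two_mem_HolPer hq hq0 k) (monomialVec_two_neg hq0 hk),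
    sub_neg_eq_add, zero_add]

lemma fourierCoefAt_monomialVec_two (hq : ‖q‖ < 1) (hq0 : q ≠ 0) (k : ℤ) (w : ℂ) (n : ℤ) :
    fourierCoefAt (monomialVec q q 2 k) w (2 * n + k) =
      q ^ n * q ^ (2 * (n * (n - 1) / 2) + k * n) :=
  fourierCoefAt_monomialVec (d := 2) hq hq0 hq0 two_ne_zero k w n

lemma hasSum_fourierCoefAt_mul_monomialVec_two (hq : ‖q‖ < 1) (hq0 : q ≠ 0) (k : ℤ) {F : ℂ → ℂ}
    {w : ℂ} (hF : Continuous fun t : ℝ => F (w + t)) (n : ℤ) :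
    HasSum (fun m : ℤ => fourierCoefAt (monomialVec q q 2 k) w m * fourierCoefAt F w (n - m))
      (fourierCoefAt (fun z => F z * monomialVec q q 2 k z) w n) := by
  have hinj : Function.Injective fun m : ℤ => 2 * m + k := fun a b h => by simpa using h
  rw [← hinj.hasSum_iff]
  · refine (hasSum_fourierCoefAt_mul hF (e := fun m : ℤ => ((2 : ℕ) : ℤ) * m + k)
      (fun t => hasSum_monomialVec hq hq0 hq0 two_ne_zero k (w + t)) n).congr_fun fun m => ?_
    rw [Function.comp, fourierCoefAt_monomialVec_two hq hq0]
    rfl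
  · intro m hm
    have h := fourierCoefAt_monomialVec_eq_zero (d := 2) hq hq0 hq0 two_ne_zero k w (n := m)
      fun ⟨l, hl⟩ => hm ⟨l, by push_cast at hl; simp only; linarith⟩
    rw [show monomialVec q q 2 k = monomialVec q q (2 : ℕ) k from rfl, h, zero_mul]

lemma hasSum_fourierCoefAt_rrVec (hq : ‖q‖ < 1) (hq0 : q ≠ 0) (k : ℤ) {w : ℂ}
    (hw : w ∈ lowerHalf) (n : ℤ) :
    HasSum (fun m : ℕ => fourierCoefAt (monomialVec q q 2 k) w (m + n) / qProdFin q q m)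
      (fourierCoefAt (rrVec q k) w n) := by
  have hc : Continuous fun t : ℝ => monomialVec q q 2 k (w + t) :=
    continuous_add_ofReal isStrip_univ
        (monomialVec_two_mem_HolPer hq hq0 k).1.continuousOn trivial
  have h1 : fourierCoefAt (rrVec q k) w n =
      fourierCoefAt (fun z => monomialVec q q 2 k z * (qProd (ex z)⁻¹ q)⁻¹) w n := by
    rw [fourierCoefAt, fourierCoefAt]
    refine intervalIntegral.integral_congr fun t _ => ?_
    rw [rrVec_apply (isStrip_lowerHalf.add_ofReal hw t)]
  rw [h1]
  refine (hasSum_fourierCoefAt_mul hc (e := fun m : ℕ => -(m : ℤ))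
    (α := fun m => (qProdFin q q m)⁻¹) (fun t => ?_) n).congr_fun fun m => ?_
  · refine (hasSum_inv_qProd hq (norm_inv_ex_lt_one
      (isStrip_lowerHalf.add_ofReal hw t))).congr_fun fun m => ?_
    rw [zpow_neg, zpow_natCast, inv_pow]
    field_simp
  · rw [sub_neg_eq_add, add_comm n]
    field_simp

/-- The heart of the proof. Euler's expansion of 1 / (1/x; q) gives the left sides as one-sided
series, and the Bailey transform evaluates these as convolutions with the coefficients of
`quintProd`. -/
lemma fourierCoefAt_rrVec (hq : ‖q‖ < 1) (hq0 : q ≠ 0) (hτ : ex τ = q) {k : ℤ}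
    (hk : k = 0 ∨ k = 1) {w : ℂ} (hw : w ∈ lowerHalf) :
    fourierCoefAt (rrVec q k) w 0 =
        fourierCoefAt (fun z => quintProd q z * monomialVec q q 2 k z) w 0 ∧
      fourierCoefAt (rrVec q k) w 1 =
        fourierCoefAt (fun z => quintProd q z * monomialVec q q 2 k z) w (-1) := by
  have hQc : Continuous fun t : ℝ => quintProd q (w + t) :=
    continuous_add_ofReal isStrip_univ (quintProd_mem_HolPer hq hq0).1.continuousOn trivial
  have hQ1 := fourierCoefAt_quintProd_one_sub hq hq0 w
  have hQ2 := fourierCoefAt_quintProd_add_three hq hq0 hτ w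
  have hQ0 := fourierCoefAt_quintProd_zero hq hq0 w
  have hK1 := fourierCoefAt_monomialVec_two_add_two hq hq0 hτ k w
  have hK2 := fourierCoefAt_monomialVec_two_neg hq hq0 hk w
  have h := hasSum_fourierCoefAt_mul_monomialVec_two hq hq0 k hQc
  constructor
  · refine (hasSum_fourierCoefAt_rrVec hq hq0 k hw 0).unique ?_
    simp only [add_zero]
    refine hasSum_theta_coef_div hQ1 hQ2 hK1 hK2 hq hq0 hQ0 ?_
    simpa only [zero_sub] using h 0
  · refine (hasSum_fourierCoefAt_rrVec hq hq0 k hw 1).unique ?_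
    refine hasSum_theta_coef_succ_div hQ1 hQ2 hK1 hK2 hq hq0 hQ0 ?_
    simpa only [neg_sub_left, neg_sub_comm, add_comm] using h (-1)

/-- Under translation the factors multiply to q⁻¹ · (-q x³) · (q x²) = -q x⁵. Under reflection x
contributes x², `quintProd` contributes x, and [q x²; k] is even. -/
lemma neg_mul_quintProd_mem_septSpace (hq : ‖q‖ < 1) (hq0 : q ≠ 0) (hτ : ex τ = q) {k : ℤ}
    (hk : k = 0 ∨ k = 1) :
    (fun z => -1 * (ex z ^ (1 : ℤ) * (quintProd q z * monomialVec q q 2 k z))) ∈ septSpace q τ := by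
  have hQ := quintProd_mem_HolPer hq hq0
  have hK := monomialVec_two_mem_HolPer hq hq0 k
  have hm := monomialVec_translate (d := 2) hq hq0 hq0 two_ne_zero hτ k
  refine mem_septSpace_iff.2 ⟨mem_HolPer_univ ?_ fun z => ?_, fun z => ?_, fun z => ?_⟩
  · exact ((differentiable_ex_zpow 1).mul ((differentiableOn_univ.1 hQ.1).mul
      (differentiableOn_univ.1 hK.1))).const_mul _
  · simp only [hQ.2.1 z trivial, hK.2.1 z trivial, ex_add_one]
  · have h1 := hm z
    norm_num at h1
    rw [h1, quintProd_translate hq hq0 hτ z, ex_add z τ, hτ]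
    norm_cast
    ring
  · rw [monomialVec_two_neg hq0 hk z, quintProd_reflect hq hq0 z, ex_neg]
    have := ex_ne_zero z
    simp only [zpow_one, zpow_zero]
    field_simp

lemma thetaProd_ex_eq (hq : ‖q‖ < 1) (z : ℂ) :
    thetaProd (ex z) q = -(ex z * qProd (q * ex z) q * qProd (ex z)⁻¹ q) := by
  have := ex_ne_zero z
  rw [thetaProd, qProd_eq_mul hq (ex z), qProd_eq_mul hq (ex z)⁻¹, ← div_eq_mul_inv]
  field_simp
  ring

lemma rrVec_mul_thetaProd (hq : ‖q‖ < 1) (hq0 : q ≠ 0) (hτ : ex τ = q) {k : ℤ}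
    (hk : k = 0 ∨ k = 1) {z : ℂ} (hz : z ∈ lowerHalf) :
    rrVec q k z * thetaProd (ex z ^ 2) q =
      -((fourierCoefAt (rrVec q k) (-Complex.I) 0 * septVec₀ q z +
        fourierCoefAt (rrVec q k) (-Complex.I) 1 * septVec₁ q z) * qProd (q * ex z) q) := by
  obtain ⟨h0, h1⟩ := fourierCoefAt_rrVec hq hq0 hτ hk neg_I_mem_lowerHalf
  have h2 := eq_add_of_mem_septSpace hq hq0 hτ (neg_mul_quintProd_mem_septSpace hq hq0 hτ hk) z
  rw [fourierCoefAt_const_mul, fourierCoefAt_const_mul, fourierCoefAt_ex_zpow_mul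
    (fun z => quintProd q z * monomialVec q q 2 k z), fourierCoefAt_ex_zpow_mul
    (fun z => quintProd q z * monomialVec q q 2 k z), sub_self, zero_sub, ← h0, ← h1,
    zpow_one] at h2
  have h3 : qProd (ex z)⁻¹ q ≠ 0 := qProd_ne_zero_of_norm_lt_one hq (norm_inv_ex_lt_one hz)
  rw [rrVec_apply hz, ← quintProd_mul_thetaProd hq hq0, thetaProd_ex_eq hq]
  generalize qProd (ex z)⁻¹ q = P at h3
  generalize qProd (q * ex z) q = P'
  field_simp
  linear_combination h2 * P'

/-- The coordinates of `T_{H⁻}(q x² - x)`: the Fourier coefficients at `1` and at `x`. -/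
noncomputable def rrCoord (q τ : ℂ) : TSpace τ lowerHalf (rrFactor q) →ₗ[ℂ] Fin 2 → ℂ :=
  fourierCoefPair isStrip_lowerHalf (TSpace_le_HolPer _ _ _) neg_I_mem_lowerHalf ![0, 1]

lemma rrCoord_injective (hq0 : q ≠ 0) (hτ : ex τ = q) : Function.Injective (rrCoord q τ) := by
  refine (injective_iff_map_eq_zero _).2 fun F hF => Subtype.ext ?_
  exact eq_zero_of_mem_TSpace_rrFactor hq0 hτ F.2 neg_I_mem_lowerHalf (congrFun hF 0)
    (congrFun hF 1)

/-- After cancelling 1 / (1/x; q), one theta series has only even powers of x and the other only odd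
ones. -/
lemma linearIndependent_rrVec (hq : ‖q‖ < 1) (hq0 : q ≠ 0) (hτ : ex τ = q) :
    LinearIndependent ℂ ![(⟨rrVec q 0, rrVec_mem hq hq0 hτ 0⟩ : TSpace τ lowerHalf (rrFactor q)),
      ⟨rrVec q 1, rrVec_mem hq hq0 hτ 1⟩] := by
  refine LinearIndependent.pair_iff.2 fun s t hst => ?_
  have h1 : ∀ z ∈ lowerHalf, s * monomialVec q q 2 0 z + t * monomialVec q q 2 1 z = 0 := by
    intro z hz
    have h2 := congrArg (fun G : TSpace τ lowerHalf (rrFactor q) => (G : ℂ → ℂ) z) hst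
    simp only [Submodule.coe_add, Submodule.coe_smul, Pi.add_apply, Pi.smul_apply, smul_eq_mul,
      Submodule.coe_zero, Pi.zero_apply, rrVec_apply hz] at h2
    have h3 : qProd (ex z)⁻¹ q ≠ 0 := qProd_ne_zero_of_norm_lt_one hq (norm_inv_ex_lt_one hz)
    rw [← mul_assoc, ← mul_assoc, ← add_mul] at h2
    exact (mul_eq_zero.1 h2).resolve_right (inv_ne_zero h3)
  have hcoef : ∀ n, s * fourierCoefAt (monomialVec q q 2 0) (-Complex.I) n +
      t * fourierCoefAt (monomialVec q q 2 1) (-Complex.I) n = 0 := by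
    intro n
    have hc : ∀ k, Continuous fun r : ℝ => monomialVec q q 2 k (-Complex.I + r) := fun k =>
      continuous_add_ofReal isStrip_univ
        (monomialVec_two_mem_HolPer hq hq0 k).1.continuousOn trivial
    rw [← fourierCoefAt_const_mul, ← fourierCoefAt_const_mul,
      ← fourierCoefAt_add ((hc 0).const_mul s) ((hc 1).const_mul t), fourierCoefAt]
    have : ∀ r : ℝ, s * monomialVec q q 2 0 (-Complex.I + r) +
        t * monomialVec q q 2 1 (-Complex.I + r) = 0 := fun r =>
      h1 _ (isStrip_lowerHalf.add_ofReal neg_I_mem_lowerHalf r)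
    simp only [this, zero_mul, intervalIntegral.integral_zero]
  have hself : ∀ k, fourierCoefAt (monomialVec q q 2 k) (-Complex.I) k = 1 := fun k => by
    have := fourierCoefAt_monomialVec_two hq hq0 k (-Complex.I) 0
    simpa using this
  have hne : ∀ k n : ℤ, ¬ (2 : ℤ) ∣ n - k →
      fourierCoefAt (monomialVec q q 2 k) (-Complex.I) n = 0 :=
    fun k n h => fourierCoefAt_monomialVec_eq_zero (d := 2) hq hq0 hq0 two_ne_zero k _ h
  have h0 := hcoef 0
  have h1 := hcoef 1
  rw [hself, hne 1 0 (by norm_num)] at h0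
  rw [hself, hne 0 1 (by norm_num)] at h1
  constructor
  · linear_combination h0
  · linear_combination h1

lemma finrank_TSpace_rrFactor (hq : ‖q‖ < 1) (hq0 : q ≠ 0) (hτ : ex τ = q) :
    Module.Finite ℂ (TSpace τ lowerHalf (rrFactor q)) ∧
      Module.finrank ℂ (TSpace τ lowerHalf (rrFactor q)) = 2 := by
  have hfin : Module.Finite ℂ (TSpace τ lowerHalf (rrFactor q)) :=
    Module.Finite.of_injective _ (rrCoord_injective hq0 hτ)
  refine ⟨hfin, le_antisymm ?_ ?_⟩
  · simpa using LinearMap.finrank_le_finrank_of_injective (rrCoord_injective (q := q) hq0 hτ)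
  · simpa using (linearIndependent_rrVec hq hq0 hτ).fintype_card_le_finrank

lemma exists_eq_add_rrVec (hq : ‖q‖ < 1) (hq0 : q ≠ 0) (hτ : ex τ = q) {F : ℂ → ℂ}
    (hF : F ∈ TSpace τ lowerHalf (rrFactor q)) :
    ∃ s t : ℂ, F = fun z => s * rrVec q 0 z + t * rrVec q 1 z := by
  obtain ⟨hfin, hrank⟩ := finrank_TSpace_rrFactor hq hq0 hτ
  have hspan := (linearIndependent_rrVec hq hq0 hτ).span_eq_top_of_card_eq_finrank'
    (by rw [hrank]; simp)
  have hmem : (⟨F, hF⟩ : TSpace τ lowerHalf (rrFactor q)) ∈ (⊤ : Submodule ℂ _) := trivial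
  rw [← hspan, Matrix.range_cons, Matrix.range_cons, Matrix.range_empty, Set.union_empty,
    Set.singleton_union, Submodule.mem_span_pair] at hmem
  obtain ⟨s, t, hst⟩ := hmem
  exact ⟨s, t, (congrArg Subtype.val hst).symm⟩

/-- Multiplication by `-⟨x²; q⟩ / (q x; q)` maps `T_{H⁻}(q x² - x)` to
`T_ℂ(-q x⁵) ∩ S_ℂ(x³)`, and takes the coordinates to the coordinates. -/
lemma mul_thetaProd_of_mem_TSpace (hq : ‖q‖ < 1) (hq0 : q ≠ 0) (hτ : ex τ = q) {F : ℂ → ℂ}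
    (hF : F ∈ TSpace τ lowerHalf (rrFactor q)) {z : ℂ} (hz : z ∈ lowerHalf) :
    F z * thetaProd (ex z ^ 2) q =
      -((fourierCoefAt F (-Complex.I) 0 * septVec₀ q z +
        fourierCoefAt F (-Complex.I) 1 * septVec₁ q z) * qProd (q * ex z) q) := by
  obtain ⟨s, t, rfl⟩ := exists_eq_add_rrVec hq hq0 hτ hF
  have hc : ∀ k, Continuous fun r : ℝ => rrVec q k (-Complex.I + r) := fun k =>
    continuous_add_ofReal isStrip_lowerHalf (rrVec_mem hq hq0 hτ k).1.1.continuousOn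
      neg_I_mem_lowerHalf
  have hadd : ∀ n, fourierCoefAt (fun z => s * rrVec q 0 z + t * rrVec q 1 z) (-Complex.I) n =
      s * fourierCoefAt (rrVec q 0) (-Complex.I) n + t * fourierCoefAt (rrVec q 1) (-Complex.I) n :=
    fun n => by
      rw [fourierCoefAt_add ((hc 0).const_mul s) ((hc 1).const_mul t), fourierCoefAt_const_mul,
        fourierCoefAt_const_mul]
  rw [hadd, hadd]
  linear_combination s * rrVec_mul_thetaProd hq hq0 hτ (Or.inl rfl) hz +
    t * rrVec_mul_thetaProd hq hq0 hτ (Or.inr rfl) hz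

/-- The basis of `T_{H⁻}(q x² - x)` dual to the Fourier coefficients at `1` and at `x`. -/
lemma exists_basis_TSpace (hq : ‖q‖ < 1) (hq0 : q ≠ 0) (hτ : ex τ = q) :
    ∃ B : Module.Basis (Fin 2) ℂ (TSpace τ lowerHalf (rrFactor q)),
      ∀ F, B.equivFun F = rrCoord q τ F := by
  obtain ⟨hfin, hrank⟩ := finrank_TSpace_rrFactor hq hq0 hτ
  exact ⟨Module.Basis.ofEquivFun (LinearEquiv.ofInjectiveOfFinrankEq (rrCoord q τ)
    (rrCoord_injective hq0 hτ) (by rw [hrank]; simp)), fun F => by simp; rfl⟩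

/-- The formula for `rrVec` makes sense on all of ℂ as a quotient of entire functions. -/
lemma exists_meromorphicContinuation (hq : ‖q‖ < 1) (hq0 : q ≠ 0) (hτ : ex τ = q) {F : ℂ → ℂ}
    (hF : F ∈ TSpace τ lowerHalf (rrFactor q)) :
    ∃ M : ℂ → ℂ, IsMeromorphicContinuation lowerHalf F M := by
  obtain ⟨s, t, rfl⟩ := exists_eq_add_rrVec hq hq0 hτ hF
  have hmer : ∀ {G : ℂ → ℂ}, Differentiable ℂ G → MeromorphicOn G Set.univ := fun hG z _ =>
    (hG.analyticAt z).meromorphicAt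
  have hK := fun k => hmer (differentiableOn_univ.1 (monomialVec_two_mem_HolPer hq hq0 k).1)
  have hP : MeromorphicOn (fun z => (qProd (ex z)⁻¹ q)⁻¹) Set.univ :=
    (hmer ((differentiable_qProd hq).comp (differentiable_ex.inv ex_ne_zero))).inv
  refine ⟨fun z => s * (monomialVec q q 2 0 z * (qProd (ex z)⁻¹ q)⁻¹) +
    t * (monomialVec q q 2 1 z * (qProd (ex z)⁻¹ q)⁻¹), ?_, fun z hz => ?_⟩
  · exact ((hmer (differentiable_const s)).mul ((hK 0).mul hP)).add
      ((hmer (differentiable_const t)).mul ((hK 1).mul hP))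
  · simp only [rrVec_apply hz]

end RRSpace

/-! ### Identity theorems -/

section Identity

variable {q τ : ℂ}

lemma eventually_codiscrete_ne_zero {F : ℂ → ℂ} (hF : Differentiable ℂ F) {z₀ : ℂ} (h : F z₀ ≠ 0) :
    ∀ᶠ z in codiscrete ℂ, F z ≠ 0 := by
  have hm : MeromorphicOn F Set.univ := fun z _ => (hF.analyticAt z).meromorphicAt
  refine MeromorphicAt.MeromorphicOn.codiscreteWithin_setOfPred_ne_zero hm fun u _ => ?_
  refine hm.meromorphicOrderAt_ne_top_of_isPreconnected isPreconnected_univ (Set.mem_univ z₀)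
    (Set.mem_univ u) ?_
  rw [meromorphicOrderAt_ne_top_iff_eventually_ne_zero (hm z₀ trivial)]
  exact (hF.continuous.continuousAt.eventually_ne h).filter_mono nhdsWithin_le_nhds

/-- Infinite order at one point spreads over the connected plane. The conclusion is codiscrete
because values at poles are arbitrary. -/
lemma eventuallyEq_zero_of_eqOn_lowerHalf {M : ℂ → ℂ} (hM : MeromorphicOn M Set.univ)
    (h : ∀ z ∈ lowerHalf, M z = 0) : ∀ᶠ z in codiscrete ℂ, M z = 0 := by
  have htop : meromorphicOrderAt M (-Complex.I) = ⊤ := by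
    rw [meromorphicOrderAt_eq_top_iff]
    refine Eventually.filter_mono nhdsWithin_le_nhds ?_
    filter_upwards [isOpen_lowerHalf.mem_nhds neg_I_mem_lowerHalf] with z hz using h z hz
  refine (mem_codiscreteWithin_iff_forall_mem_nhdsNE).2 fun u _ => ?_
  have hu : meromorphicOrderAt M u = ⊤ := by
    by_contra hu
    exact hM.meromorphicOrderAt_ne_top_of_isPreconnected isPreconnected_univ (Set.mem_univ u)
      (Set.mem_univ _) hu htop
  filter_upwards [meromorphicOrderAt_eq_top_iff.1 hu] with z hz using Or.inl hz

/-- Cancels a factor that may vanish: its zeros are isolated, and continuity of D fills them in. -/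
lemma eqOn_zero_of_mul_eq_zero {D G : ℂ → ℂ} {U : Set ℂ} (hU : IsOpen U) (hD : ContinuousOn D U)
    (hG : Differentiable ℂ G) {z₀ : ℂ} (hz₀ : G z₀ ≠ 0) (h : ∀ z ∈ U, D z * G z = 0) :
    ∀ z ∈ U, D z = 0 := by
  intro z hz
  have h1 : ∀ᶠ u in 𝓝[≠] z, G u ≠ 0 := by
    have := (mem_codiscreteWithin_iff_forall_mem_nhdsNE).1
      (eventually_codiscrete_ne_zero hG hz₀) z trivial
    filter_upwards [this] with u hu using hu.elim id fun h => (h trivial).elim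
  have h2 : ∀ᶠ u in 𝓝[≠] z, D u = 0 := by
    filter_upwards [h1, mem_nhdsWithin_of_mem_nhds (hU.mem_nhds hz)] with u hu huU
    exact (mul_eq_zero.1 (h u huU)).resolve_right hu
  have h3 : Tendsto D (𝓝[≠] z) (𝓝 (D z)) :=
    (hD.continuousAt (hU.mem_nhds hz)).tendsto.mono_left nhdsWithin_le_nhds
  exact tendsto_nhds_unique h3 (tendsto_const_nhds.congr' (h2.mono fun u hu => hu.symm))

lemma eq_zero_of_eqOn_lowerHalf {D : ℂ → ℂ} (hD : Differentiable ℂ D)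
    (h : ∀ z ∈ lowerHalf, D z = 0) (z : ℂ) : D z = 0 := by
  by_contra hz
  have h1 := (mem_codiscreteWithin_iff_forall_mem_nhdsNE).1
    (eventually_codiscrete_ne_zero hD hz) (-Complex.I) trivial
  have h2 : ∀ᶠ u in 𝓝[≠] (-Complex.I), D u = 0 := by
    filter_upwards [mem_nhdsWithin_of_mem_nhds (isOpen_lowerHalf.mem_nhds neg_I_mem_lowerHalf)]
      with u hu using h u hu
  obtain ⟨u, hu1, hu2⟩ := (Eventually.and h2 h1).exists
  exact hu2.elim (fun h => h hu1) fun h => h trivial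

end Identity

/-! ### The products -/

section Products

variable {q τ : ℂ}

lemma septProduct_eq (hq : ‖q‖ < 1) (hq0 : q ≠ 0) (z : ℂ) :
    septProduct q z = qProd q q * thetaProd (ex z) q * thetaProd (ex z ^ 2) q := by
  rw [septProduct, thetaProd_eq_even_mul_odd hq hq0 (ex z ^ 2)]
  ring

lemma septProduct_mul_qProd (hq : ‖q‖ < 1) (hq0 : q ≠ 0) (z : ℂ) :
    septProduct q z * qProd (q * ex z) q = rrProduct q z * thetaProd (ex z ^ 2) q := by
  rw [septProduct_eq hq hq0, rrProduct]
  ring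

lemma differentiable_thetaProd_ex_pow (hq : ‖q‖ < 1) (n : ℕ) :
    Differentiable ℂ fun z => thetaProd (ex z ^ n) q :=
  differentiable_thetaProd_comp hq (differentiable_ex.pow n) fun z => pow_ne_zero n (ex_ne_zero z)

lemma differentiable_thetaProd_ex (hq : ‖q‖ < 1) : Differentiable ℂ fun z => thetaProd (ex z) q :=
  differentiable_thetaProd_comp hq differentiable_ex ex_ne_zero

lemma differentiable_qProd_ex (hq : ‖q‖ < 1) : Differentiable ℂ fun z => qProd (q * ex z) q :=
  (differentiable_qProd hq).comp (differentiable_ex.const_mul q)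

lemma differentiable_rrProduct (hq : ‖q‖ < 1) : Differentiable ℂ (rrProduct q) :=
  ((differentiable_thetaProd_ex hq).const_mul _).mul (differentiable_qProd_ex hq)

lemma differentiable_septProduct (hq : ‖q‖ < 1) (hq0 : q ≠ 0) :
    Differentiable ℂ (septProduct q) := by
  rw [funext (septProduct_eq hq hq0)]
  exact ((differentiable_thetaProd_ex hq).const_mul _).mul (differentiable_thetaProd_ex_pow hq 2)

/-- Here q / y = y, so the product is the square of (y; q) with |y| < 1. This supplies points where
the theta factors to be cancelled do not vanish. -/
lemma thetaProd_sqrt_ne_zero (hq : ‖q‖ < 1) (hq0 : q ≠ 0) {y : ℂ} (hy : y ^ 2 = q) :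
    thetaProd y q ≠ 0 := by
  have hy0 : y ≠ 0 := fun h => hq0 (by rw [← hy, h]; simp)
  have hy1 : ‖y‖ < 1 := by
    rw [← hy, norm_pow] at hq
    exact (pow_lt_one_iff_of_nonneg (norm_nonneg y) two_ne_zero).1 hq
  have h2 : q / y = y := by rw [← hy]; field_simp
  rw [thetaProd, h2]
  exact mul_ne_zero (qProd_ne_zero_of_norm_lt_one hq hy1) (qProd_ne_zero_of_norm_lt_one hq hy1)

lemma thetaProd_ex_ne_zero (hq : ‖q‖ < 1) (hq0 : q ≠ 0) (hτ : ex τ = q) :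
    thetaProd (ex (τ / 2)) q ≠ 0 :=
  thetaProd_sqrt_ne_zero hq hq0 (by rw [sq, ← ex_add, add_halves, hτ])

lemma thetaProd_ex_sq_ne_zero (hq : ‖q‖ < 1) (hq0 : q ≠ 0) (hτ : ex τ = q) :
    thetaProd (ex (τ / 2 / 2) ^ 2) q ≠ 0 :=
  thetaProd_sqrt_ne_zero hq hq0 (by
    rw [sq (ex _), ← ex_add, add_halves, sq, ← ex_add, add_halves, hτ])

lemma qProd_ex_ne_zero (hq : ‖q‖ < 1) : qProd (q * ex 0) q ≠ 0 := by
  rw [ex_zero, mul_one]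
  exact qProd_self_ne_zero hq

lemma hasSum_rrProduct (hq : ‖q‖ < 1) (hq0 : q ≠ 0) (z : ℂ) :
    HasSum (fun p : ℤ × ℕ =>
        q ^ (p.1 * (p.1 - 1) / 2 + ((p.2 : ℤ) + 1) * (p.2 : ℤ) / 2) / qProdFin q q p.2 *
          (-ex z) ^ (p.1 + (p.2 : ℤ))) (rrProduct q z) := by
  have hx := ex_ne_zero z
  have h1 := hasSum_thetaProd hq hq0 hx
  have h2 := hasSum_qProd hq (q * ex z)
  refine (HasSum.mul (f := fun m : ℤ => (-1) ^ m * q ^ (m * (m - 1) / 2) * ex z ^ m)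
    (g := fun n : ℕ => eulerCoef q n * (q * ex z) ^ n) h1 h2
    (summable_mul_of_summable_norm
      (f := fun m : ℤ => (-1) ^ m * q ^ (m * (m - 1) / 2) * ex z ^ m)
      (g := fun n : ℕ => eulerCoef q n * (q * ex z) ^ n) h1.summable.norm
      h2.summable.norm)).congr_fun fun p => ?_
  obtain ⟨m, n⟩ := p
  have h3 : ((n : ℤ) + 1) * n / 2 = n.choose 2 + n := by
    have h4 := Int.two_mul_mul_sub_one_ediv_two ((n : ℤ) + 1)
    rw [add_sub_cancel_right] at h4
    have h5 := Nat.two_mul_choose_two_cast n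
    refine mul_left_cancel₀ (two_ne_zero (α := ℤ)) ?_
    rw [h4, mul_add, h5]
    ring
  simp only [h3, eulerCoef]
  rw [neg_eq_neg_one_mul, mul_zpow, zpow_add₀ hq0, zpow_add₀ hq0, zpow_add₀ hx,
    zpow_add₀ (by norm_num : (-1 : ℂ) ≠ 0)]
  simp only [zpow_natCast]
  ring

end Products

/-! ### The main theorem -/

section Main

variable {q τ : ℂ}

/-- Being dual to the coefficients on one line suffices, as these do not depend on the line. -/
lemma isCanonicalVec_iff (B : Module.Basis (Fin 2) ℂ (TSpace τ lowerHalf (rrFactor q)))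
    (hB : ∀ F, B.equivFun F = rrCoord q τ F) (k : Fin 2) (F : ℂ → ℂ) :
    IsCanonicalVec τ (rrFactor q) 2 k F ↔ F = (B k : ℂ → ℂ) := by
  have hco : ∀ (F : TSpace τ lowerHalf (rrFactor q)) (j : Fin 2),
      B.equivFun F j = fourierCoefAt F (-Complex.I) ((j : ℕ) : ℤ) := by
    intro F j
    rw [hB]
    fin_cases j <;> rfl
  constructor
  · rintro ⟨hF, h⟩
    have : (⟨F, hF⟩ : TSpace τ lowerHalf (rrFactor q)) = B k := by
      apply B.equivFun.injective
      ext j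
      rw [hco, h j _ neg_I_mem_lowerHalf, Module.Basis.equivFun_self]
      simp only [eq_comm]
    exact congrArg Subtype.val this
  · rintro rfl
    refine ⟨(B k).2, fun j w hw => ?_⟩
    rw [fourierCoefAt_eq_of_mem isStrip_lowerHalf (TSpace_le_HolPer _ _ _ (B k).2) hw
      neg_I_mem_lowerHalf, ← hco, Module.Basis.equivFun_self]
    simp only [eq_comm]

lemma exists_septVec₀_ne_zero (hq : ‖q‖ < 1) (hq0 : q ≠ 0) : ∃ z, septVec₀ q z ≠ 0 := by
  by_contra! h
  have h0 : septVec₀ q = fun _ => 0 := funext h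
  have := (fourierCoefAt_septVec₀ hq hq0 0).2
  rw [h0] at this
  simp [fourierCoefAt] at this

lemma exists_septVec₁_ne_zero (hq : ‖q‖ < 1) (hq0 : q ≠ 0) : ∃ z, septVec₁ q z ≠ 0 := by
  by_contra! h
  have h0 : septVec₁ q = fun _ => 0 := funext h
  have := (fourierCoefAt_septVec₁ hq hq0 0).1
  rw [h0] at this
  simp [fourierCoefAt] at this

lemma differentiable_septVec₀ (hq : ‖q‖ < 1) (hq0 : q ≠ 0) (hτ : ex τ = q) :
    Differentiable ℂ (septVec₀ q) :=
  differentiableOn_univ.1 (septVec₀_mem hq hq0 hτ).1.1.1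

lemma differentiable_septVec₁ (hq : ‖q‖ < 1) (hq0 : q ≠ 0) (hτ : ex τ = q) :
    Differentiable ℂ (septVec₁ q) :=
  differentiableOn_univ.1 (septVec₁_mem hq hq0 hτ).1.1.1

lemma Differentiable.meromorphicOn_univ {F : ℂ → ℂ} (hF : Differentiable ℂ F) :
    MeromorphicOn F Set.univ :=
  fun z _ => (hF.analyticAt z).meromorphicAt

/-- A proportionality `M θ = -s P` valid on the lower half-plane gives the equality of the
meromorphic functions `-θ / P` and `s / M`. -/
lemma neg_div_eventuallyEq_div {M s θ P : ℂ → ℂ} (hM : MeromorphicOn M Set.univ)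
    (hs : Differentiable ℂ s) (hθ : Differentiable ℂ θ) (hP : Differentiable ℂ P)
    (hs0 : ∃ z, s z ≠ 0) (hθ0 : ∃ z, θ z ≠ 0) (hP0 : ∃ z, P z ≠ 0)
    (h : ∀ z ∈ lowerHalf, M z * θ z = -(s z * P z)) :
    (fun z => -(θ z / P z)) =ᶠ[codiscrete ℂ] fun z => s z / M z := by
  have hz : ∀ᶠ z in codiscrete ℂ, (M * θ + s * P) z = 0 := by
    refine eventuallyEq_zero_of_eqOn_lowerHalf ((hM.mul hθ.meromorphicOn_univ).add
      (hs.meromorphicOn_univ.mul hP.meromorphicOn_univ)) fun z hz => ?_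
    simp [h z hz]
  obtain ⟨a, ha⟩ := hs0
  obtain ⟨b, hb⟩ := hθ0
  obtain ⟨c, hc⟩ := hP0
  filter_upwards [hz, eventually_codiscrete_ne_zero hs ha, eventually_codiscrete_ne_zero hθ hb,
    eventually_codiscrete_ne_zero hP hc] with z h1 h2 h3 h4
  simp only [Pi.add_apply, Pi.mul_apply] at h1
  have h5 : M z ≠ 0 := by
    intro h5
    rw [h5, zero_mul, zero_add] at h1
    exact (mul_ne_zero h2 h4) h1
  rw [← neg_div, div_eq_div_iff h4 h5]
  linear_combination -h1

/-- The quotient of the septuple product by `(q; q) ⟨x; q⟩ (q x; q)`. -/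
lemma neg_div_eventuallyEq_neg_septProduct_div (hq : ‖q‖ < 1) (hq0 : q ≠ 0) (hτ : ex τ = q) :
    (fun z => -(thetaProd (ex z ^ 2) q / qProd (q * ex z) q)) =ᶠ[codiscrete ℂ]
      fun z => -(septProduct q z / rrProduct q z) := by
  filter_upwards [eventually_codiscrete_ne_zero (differentiable_thetaProd_ex hq)
    (thetaProd_ex_ne_zero hq hq0 hτ)] with z hz
  rw [septProduct_eq hq hq0, rrProduct,
    mul_div_mul_left _ _ (mul_ne_zero (qProd_self_ne_zero hq) hz)]

/-- Expansions of the two products in the two bases have the same coefficients up to sign. -/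
lemma septProduct_expansion_iff (hq : ‖q‖ < 1) (hq0 : q ≠ 0) (hτ : ex τ = q) {E₀ E₁ : ℂ → ℂ}
    (hE₀ : DifferentiableOn ℂ E₀ lowerHalf) (hE₁ : DifferentiableOn ℂ E₁ lowerHalf)
    (h₀ : ∀ z ∈ lowerHalf,
      E₀ z * thetaProd (ex z ^ 2) q = -(septVec₀ q z * qProd (q * ex z) q))
    (h₁ : ∀ z ∈ lowerHalf,
      E₁ z * thetaProd (ex z ^ 2) q = -(septVec₁ q z * qProd (q * ex z) q)) (a₀ a₁ : ℂ) :
    (∀ z : ℂ, septProduct q z = -(a₀ * septVec₀ q z) + a₁ * septVec₁ q z) ↔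
      ∀ z ∈ lowerHalf, rrProduct q z = a₀ * E₀ z - a₁ * E₁ z := by
  constructor
  · intro h z hz
    have hD : ContinuousOn (fun z => rrProduct q z - (a₀ * E₀ z - a₁ * E₁ z)) lowerHalf :=
      (differentiable_rrProduct hq).continuous.continuousOn.sub
        ((hE₀.continuousOn.const_mul a₀).sub (hE₁.continuousOn.const_mul a₁))
    refine sub_eq_zero.1 (eqOn_zero_of_mul_eq_zero isOpen_lowerHalf hD
      (differentiable_thetaProd_ex_pow hq 2) (thetaProd_ex_sq_ne_zero hq hq0 hτ)
      (fun u hu => ?_) z hz)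
    have := septProduct_mul_qProd hq hq0 u
    rw [h u] at this
    linear_combination -this - a₀ * h₀ u hu + a₁ * h₁ u hu
  · intro h z
    have hD : Differentiable ℂ
        (fun z => septProduct q z - (-(a₀ * septVec₀ q z) + a₁ * septVec₁ q z)) :=
      (differentiable_septProduct hq hq0).sub
        (((differentiable_septVec₀ hq hq0 hτ).const_mul a₀).neg.add
          ((differentiable_septVec₁ hq hq0 hτ).const_mul a₁))
    refine sub_eq_zero.1 (eq_zero_of_eqOn_lowerHalf hD (eqOn_zero_of_mul_eq_zero
      isOpen_lowerHalf hD.continuous.continuousOn (differentiable_qProd_ex hq)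
      (qProd_ex_ne_zero hq) fun u hu => ?_) z)
    have := septProduct_mul_qProd hq hq0 u
    rw [h u hu] at this
    linear_combination this + a₀ * h₀ u hu - a₁ * h₁ u hu

end Main

theorem theorem1p3 (q τ : ℂ) (hq0 : 0 < ‖q‖) (hq1 : ‖q‖ < 1) (hτ : ex τ = q) :
    -- the canonical basis `([q x² - x; 0], [q x² - x; 1])` of `T_{H⁻}(q x² - x)`
    ∃ B : Module.Basis (Fin 2) ℂ (TSpace τ lowerHalf (rrFactor q)),
      (∀ (k : Fin 2) (F : ℂ → ℂ),
        IsCanonicalVec τ (rrFactor q) 2 k F ↔ F = (B k : ℂ → ℂ)) ∧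
      -- the canonical basis of `T_ℂ(-q x⁵) ∩ S_ℂ(x³)`
      (∃ b : Module.Basis (Fin 2) ℂ (septSpace q τ),
        (b 0 : ℂ → ℂ) = septVec₀ q ∧ (b 1 : ℂ → ℂ) = septVec₁ q) ∧
      -- the vectors `[q x² - x; k]` continue meromorphically to `ℂ`
      (∀ k : Fin 2, ∃ M : ℂ → ℂ, IsMeromorphicContinuation lowerHalf (B k) M) ∧
      -- the two equalities of meromorphic functions on `ℂ`
      (∀ M₀ M₁ : ℂ → ℂ,
        IsMeromorphicContinuation lowerHalf (B 0) M₀ →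
        IsMeromorphicContinuation lowerHalf (B 1) M₁ →
        ((fun z => -(thetaProd (ex z ^ 2) q / qProd (q * ex z) q))
            =ᶠ[Filter.codiscrete ℂ] fun z => septVec₀ q z / M₀ z) ∧
        ((fun z => septVec₀ q z / M₀ z)
            =ᶠ[Filter.codiscrete ℂ] fun z => septVec₁ q z / M₁ z)) ∧
      -- the left-hand side is minus the ratio of the two products
      ((fun z => -(thetaProd (ex z ^ 2) q / qProd (q * ex z) q))
          =ᶠ[Filter.codiscrete ℂ] fun z => -(septProduct q z / rrProduct q z)) ∧
      -- expansions of the two products in the two bases have the same coefficients up to sign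
      (∀ a₀ a₁ : ℂ,
        (∀ z : ℂ, septProduct q z = -(a₀ * septVec₀ q z) + a₁ * septVec₁ q z) ↔
          ∀ z ∈ lowerHalf, rrProduct q z =
            a₀ * (B 0 : ℂ → ℂ) z - a₁ * (B 1 : ℂ → ℂ) z) ∧
      -- in particular, the two identities are equivalent
      (SeptupleIdentity q ↔ TwoVarRogersRamanujan q (B 0) (B 1)) := by
  have hq : q ≠ 0 := norm_pos_iff.1 hq0
  obtain ⟨B, hB⟩ := exists_basis_TSpace hq1 hq hτ
  have hc := isCanonicalVec_iff B hB
  have hp₀ : ∀ z ∈ lowerHalf, (B 0 : ℂ → ℂ) z * thetaProd (ex z ^ 2) q =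
      -(septVec₀ q z * qProd (q * ex z) q) := by
    intro z hz
    have h := ((hc 0 _).2 rfl).2
    have h0 : fourierCoefAt (B 0) (-Complex.I) 0 = 1 := by
      simpa using h 0 _ neg_I_mem_lowerHalf
    have h1 : fourierCoefAt (B 0) (-Complex.I) 1 = 0 := by
      simpa using h 1 _ neg_I_mem_lowerHalf
    rw [mul_thetaProd_of_mem_TSpace hq1 hq hτ (B 0).2 hz, h0, h1]
    ring
  have hp₁ : ∀ z ∈ lowerHalf, (B 1 : ℂ → ℂ) z * thetaProd (ex z ^ 2) q =
      -(septVec₁ q z * qProd (q * ex z) q) := by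
    intro z hz
    have h := ((hc 1 _).2 rfl).2
    have h0 : fourierCoefAt (B 1) (-Complex.I) 0 = 0 := by
      simpa using h 0 _ neg_I_mem_lowerHalf
    have h1 : fourierCoefAt (B 1) (-Complex.I) 1 = 1 := by
      simpa using h 1 _ neg_I_mem_lowerHalf
    rw [mul_thetaProd_of_mem_TSpace hq1 hq hτ (B 1).2 hz, h0, h1]
    ring
  have hiff := septProduct_expansion_iff hq1 hq hτ (TSpace_le_HolPer _ _ _ (B 0).2).1
    (TSpace_le_HolPer _ _ _ (B 1).2).1 hp₀ hp₁
  refine ⟨B, hc, exists_basis_septSpace hq1 hq hτ,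
    fun k => exists_meromorphicContinuation hq1 hq hτ (B k).2, fun M₀ M₁ hM₀ hM₁ => ?_,
    neg_div_eventuallyEq_neg_septProduct_div hq1 hq hτ, hiff, ?_⟩
  · have e₀ := neg_div_eventuallyEq_div hM₀.1 (differentiable_septVec₀ hq1 hq hτ)
      (differentiable_thetaProd_ex_pow hq1 2) (differentiable_qProd_ex hq1)
      (exists_septVec₀_ne_zero hq1 hq) ⟨_, thetaProd_ex_sq_ne_zero hq1 hq hτ⟩
      ⟨_, qProd_ex_ne_zero hq1⟩ fun z hz => by rw [hM₀.2 hz]; exact hp₀ z hz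
    have e₁ := neg_div_eventuallyEq_div hM₁.1 (differentiable_septVec₁ hq1 hq hτ)
      (differentiable_thetaProd_ex_pow hq1 2) (differentiable_qProd_ex hq1)
      (exists_septVec₁_ne_zero hq1 hq) ⟨_, thetaProd_ex_sq_ne_zero hq1 hq hτ⟩
      ⟨_, qProd_ex_ne_zero hq1⟩ fun z hz => by rw [hM₁.2 hz]; exact hp₁ z hz
    exact ⟨e₀, e₀.symm.trans e₁⟩
  -- The double series for Π always holds, so only the equivalence of expansions at these two
  -- coefficients is needed.
  · have := hiff (thetaProd (q ^ 2) (q ^ 5))⁻¹ (thetaProd q (q ^ 5))⁻¹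
    simp only [SeptupleIdentity, TwoVarRogersRamanujan, div_eq_inv_mul _ (thetaProd _ _)]
    rw [this]
    exact ⟨fun h z hz => ⟨hasSum_rrProduct hq1 hq z, h z hz⟩, fun h z hz => (h z hz).2⟩
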